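/- Let $K$ be a field of arbitrary characteristic. All algebras are finite-dimensional $K$-algebras. An algebra $A$ is *symmetric* if it has a linear form $\varphi$ with $\varphi(xy)=\varphi(yx)$ such that $(x,y)\mapsto\varphi(xy)$ is non-degenerate; it is *indecomposable* if $A\neq 0$ and $0,1$ are its only central idempotents; it is *basic* if $A/\operatorname{rad}A\cong K\times\cdots\times K$ (over an algebraically closed field, the usual notion). The *Cartan matrix* of a basic algebra with complete set $e_1,\dots,e_n$ of primitive orthogonal idempotents is $(\dim_K e_iAe_j)_{i,j}$. Write $Z(A)$ for the centre and $R(A)=Z(A)\cap\operatorname{soc}(A)$ for the Reynolds ideal. Two algebras $A,B$ are *stably equivalent of Morita type* if there are finite-dimensional bimodules ${}_AM_B$ and ${}_BN_A$ (with $K$ acting centrally), projective as left and as right modules, such that $M\otimes_BN\cong A\oplus P$ and $N\otimes_AM\cong B\oplus Q$ as bimodules, with $P$ a projective $A$-$A$-bimodule and $Q$ a projective $B$-$B$-bimodule. Consider the following classes of basic indecomposable symmetric $K$-algebras; in each of them, $R$ is described through the given isomorphism for $Z$. * For $\ell\ge 2$, an algebra $A$ is of type $A_1^{\ell}$ if $\dim_KA=4\ell$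 and: if $\operatorname{char}K=2$, then $Z(A)\cong K[U,T,V,W]/(U^\ell,T^2,V^2,W^2,UT,UV,UW,TV,TW,VW)$ with $R(A)=KT$; if $\operatorname{char}K\ne2$, then $Z(A)\cong K[U,V,W]/(U^{\ell+1},V^2,W^2,UV,UW,VW)$ with $R(A)=KU^\ell$. * For $k,s\ge1$, an algebra $A$ is of type $A_2^{k,s}$ if its Cartan matrix is, for some numbering of the idempotents, $\begin{pmatrix}4k&2k\\2k&s+k\end{pmatrix}$ and: if $\operatorname{char}K=2$, then $Z(A)\cong K[u,v,w,t]/(u^k-v^s,w^2,t^2,uv,uw,vw,tw,ut,vt)$ with $R(A)=Ku^k\oplus Kw$; if $\operatorname{char}K\neq2$, then $Z(A)\cong K[u,v,t]/(u^{k+1},v^{s+1},t^2,uv,ut,vt)$ with $R(A)=Ku^k\oplus Kv^s$. * For $a,b,c\ge1$, an algebra $A$ is of type $A_3^{a,b,c}$ if its Cartan matrix is, for some numbering of the idempotents, $\begin{pmatrix}a+b&a&b\\a&a+c&c\\b&c&b+c\end{pmatrix}$ and $Z(A)$ is isomorphic to the quotient of $K[A,B,C,S_1,S_2,S_3]$ by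 the ideal generated by $A^{a+1}$, $B^{b+1}$, $C^{c+1}$, $A^a-S_2-S_3$, $B^b-S_3-S_1$, $C^c-S_1-S_2$, $AS_i$, $BS_i$, $CS_i$, $S_iS_j$ $(i,j\in\{1,2,3\})$, $AB$, $AC$, $BC$, with $R(A)=KS_1\oplus KS_2\oplus KS_3$. Then, for all parameters $a,b,c,k,s\ge1$ and $\ell\ge2$: 1. no algebra of type $A_3^{a,b,c}$ is stably equivalent of Morita type to an algebra of type $A_2^{k,s}$; 2. no algebra of type $A_2^{k,s}$ is stably equivalent of Morita type to an algebra of type $A_1^{\ell}$; 3. no algebra of type $A_3^{a,b,c}$ is stably equivalent of Morita type to an algebra of type $A_1^{\ell}$. -/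

import Mathlib

universe u v w

open scoped TensorProduct

namespace StableMorita

/-! ### Finite-dimensional algebras -/

section Algebras

variable (K : Type u) [Field K] (A : Type v) [Ring A] [Algebra K A]

/-- `A` is a symmetric `K`-algebra: it is finite-dimensional and carries a symmetrizing form, that
is, a linear form `φ` with `φ (a b) = φ (b a)` for which `(a, b) ↦ φ (a b)` is non-degenerate. -/
def IsSymmetricAlgebra : Prop :=
  FiniteDimensional K A ∧
    ∃ φ : A →ₗ[K] K, (∀ a b : A, φ (a * b) = φ (b * a)) ∧ ∀ a : A, (∀ b : A, φ (a * b) = 0) → a = 0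

/-- `A` is indecomposable as a ring: it is non-zero and its only central idempotents are
`0` and `1`. -/
def IsIndecomposable : Prop :=
  Nontrivial A ∧ ∀ e : A, IsIdempotentElem e → e ∈ Subring.center A → e = 0 ∨ e = 1

/-- `A` is a (split) basic `K`-algebra: `A / rad A` is isomorphic to `K × ⋯ × K`. Over an
algebraically closed field this is equivalent to `A / rad A` being a product of division rings. -/
def IsBasic : Prop :=
  ∃ n : ℕ, Nonempty ((A ⧸ Ring.jacobson A) ≃ₐ[K] (Fin n → K))

variable {A} in
/-- A primitive idempotent: a non-zero idempotent that is not the sum of two non-zero orthogonal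
idempotents. -/
def IsPrimitiveIdempotent (e : A) : Prop :=
  IsIdempotentElem e ∧ e ≠ 0 ∧
    ∀ f g : A, IsIdempotentElem f → IsIdempotentElem g → f * g = 0 → g * f = 0 → f + g = e →
      f = 0 ∨ g = 0

variable {A} in
/-- The subspace `e A f` of `A`. -/
def peirce (e f : A) : Submodule K A :=
  LinearMap.range (LinearMap.mulLeft K e ∘ₗ LinearMap.mulRight K f)

/-- `C` is the Cartan matrix of the basic algebra `A`, for some numbering of the simple modules:
for a complete set `e` of primitive orthogonal idempotents, `C i j = dim (e i A e j)`. -/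
def HasCartanMatrix {n : ℕ} (C : Matrix (Fin n) (Fin n) ℕ) : Prop :=
  ∃ e : Fin n → A, CompleteOrthogonalIdempotents e ∧ (∀ i, IsPrimitiveIdempotent (e i)) ∧
    ∀ i j, Module.finrank K (peirce K (e i) (e j)) = C i j

/-- The socle of `A`: the sum of the minimal left ideals. -/
def socle : Submodule A A :=
  sSup {S : Submodule A A | IsSimpleModule A S}

/-- The Reynolds ideal `R(A) = Z(A) ∩ soc(A)`. -/
def reynoldsIdeal : Submodule K A :=
  Subalgebra.toSubmodule (Subalgebra.center K A) ⊓ (socle A).restrictScalars K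

/-- There is an isomorphism of `K`-algebras `K[Xᵢ] / (rels) ≃ Z(A)` under which the Reynolds ideal
is the `K`-linear span of the classes of the elements of `gens`. -/
def HasCentreAndReynolds {σ : Type} (rels gens : Set (MvPolynomial σ K)) : Prop :=
  ∃ φ : (MvPolynomial σ K ⧸ Ideal.span rels) ≃ₐ[K] Subalgebra.center K A,
    reynoldsIdeal K A =
      Submodule.span K ((fun f => (φ (Ideal.Quotient.mk (Ideal.span rels) f) : A)) '' gens)

end Algebras

/-! ### Stable equivalences of Morita type -/

/-- An `A`-`B`-bimodule on which `K` acts centrally; the right action of `B` is a left action of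
`Bᵐᵒᵖ`. Finite-dimensional bimodules can always be realized in the universe of `K`. -/
structure Bimodule (K : Type u) [Field K] (A : Type v) [Ring A] [Algebra K A]
    (B : Type w) [Ring B] [Algebra K B] where
  /-- The underlying type. -/
  carrier : Type u
  [addCommGroup : AddCommGroup carrier]
  [module : Module K carrier]
  [leftModule : Module A carrier]
  [rightModule : Module Bᵐᵒᵖ carrier]
  [leftTower : IsScalarTower K A carrier]
  [rightTower : IsScalarTower K Bᵐᵒᵖ carrier]
  [comm : SMulCommClass A Bᵐᵒᵖ carrier]

attribute [instance] Bimodule.addCommGroup Bimodule.module Bimodule.leftModule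
  Bimodule.rightModule Bimodule.leftTower Bimodule.rightTower Bimodule.comm

section Bimodules

variable {K : Type u} [Field K] {A : Type v} [Ring A] [Algebra K A]
  {B : Type w} [Ring B] [Algebra K B]

/-- The kernel of `M ⊗[K] N → M ⊗[B] N`, spanned by the elements `(m b) ⊗ n - m ⊗ (b n)`. -/
def balancingSubmodule (M : Bimodule K A B) (N : Bimodule K B A) :
    Submodule K (M.carrier ⊗[K] N.carrier) :=
  Submodule.span K {x | ∃ (m : M.carrier) (b : B) (n : N.carrier),
    x = (MulOpposite.op b • m) ⊗ₜ[K] n - m ⊗ₜ[K] (b • n)}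

/-- The tensor product `M ⊗[B] N` of an `A`-`B`-bimodule and a `B`-`A`-bimodule. -/
abbrev BalancedTensor (M : Bimodule K A B) (N : Bimodule K B A) : Type u :=
  (M.carrier ⊗[K] N.carrier) ⧸ balancingSubmodule M N

/-- The class of `m ⊗ n` in `M ⊗[B] N`. -/
def balancedTmul (M : Bimodule K A B) (N : Bimodule K B A) (m : M.carrier) (n : N.carrier) :
    BalancedTensor M N :=
  (balancingSubmodule M N).mkQ (m ⊗ₜ[K] n)

/-- `M ⊗[B] N` is isomorphic to `A ⊕ P` as an `A`-`A`-bimodule. The actions on `M ⊗[B] N` are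
`a (m ⊗ n) = (a m) ⊗ n` and `(m ⊗ n) a = m ⊗ (n a)`; as the elements `m ⊗ n` span `M ⊗[B] N`,
a linear isomorphism is an isomorphism of bimodules as soon as it respects the actions on them. -/
def TensorIsoRegularSum (M : Bimodule K A B) (N : Bimodule K B A) (P : Bimodule K A A) : Prop :=
  ∃ Φ : BalancedTensor M N ≃ₗ[K] A × P.carrier,
    (∀ (a : A) (m : M.carrier) (n : N.carrier),
      Φ (balancedTmul M N (a • m) n) = a • Φ (balancedTmul M N m n)) ∧
    ∀ (a : A) (m : M.carrier) (n : N.carrier),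
      Φ (balancedTmul M N m (MulOpposite.op a • n)) = MulOpposite.op a • Φ (balancedTmul M N m n)

attribute [local instance] TensorProduct.Algebra.module in
/-- `P` is projective as an `A`-`A`-bimodule, that is, as a module over `A ⊗[K] Aᵐᵒᵖ`. -/
def IsProjectiveBimodule (P : Bimodule K A A) : Prop :=
  Module.Projective (A ⊗[K] Aᵐᵒᵖ) P.carrier

variable (K A B) in
/-- `A` and `B` are stably equivalent of Morita type: there are finite-dimensional bimodules
`M` (over `A`-`B`) and `N` (over `B`-`A`), projective as left and as right modules, and projective
bimodules `P` and `Q` with `M ⊗[B] N ≃ A ⊕ P` and `N ⊗[A] M ≃ B ⊕ Q` as bimodules. -/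
def StablyEquivalentOfMoritaType : Prop :=
  ∃ (M : Bimodule K A B) (N : Bimodule K B A) (P : Bimodule K A A) (Q : Bimodule K B B),
    FiniteDimensional K M.carrier ∧ FiniteDimensional K N.carrier ∧
    Module.Projective A M.carrier ∧ Module.Projective Bᵐᵒᵖ M.carrier ∧
    Module.Projective B N.carrier ∧ Module.Projective Aᵐᵒᵖ N.carrier ∧
    IsProjectiveBimodule P ∧ IsProjectiveBimodule Q ∧
    TensorIsoRegularSum M N P ∧ TensorIsoRegularSum N M Q

end Bimodules

/-! ### The three classes of algebras -/

section Classes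

open MvPolynomial

variable (K : Type u) [Field K]

/-- The relations of `K[U, T, V, W]` in characteristic `2` for the one-simple class. -/
def oneRelsCharTwo (l : ℕ) : Set (MvPolynomial (Fin 4) K) :=
  let U := X 0; let T := X 1; let V := X 2; let W := X 3
  {U ^ l, T ^ 2, V ^ 2, W ^ 2, U * T, U * V, U * W, T * V, T * W, V * W}

/-- The relations of `K[U, V, W]` in characteristic different from `2` for the one-simple class. -/
def oneRels (l : ℕ) : Set (MvPolynomial (Fin 3) K) :=
  let U := X 0; let V := X 1; let W := X 2
  {U ^ (l + 1), V ^ 2, W ^ 2, U * V, U * W, V * W}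

/-- The relations of `K[u, v, w, t]` in characteristic `2` for the two-simples class. -/
def twoRelsCharTwo (k s : ℕ) : Set (MvPolynomial (Fin 4) K) :=
  let u := X 0; let v := X 1; let w := X 2; let t := X 3
  {u ^ k - v ^ s, w ^ 2, t ^ 2, u * v, u * w, v * w, t * w, u * t, v * t}

/-- The relations of `K[u, v, t]` in characteristic different from `2` for the two-simples class. -/
def twoRels (k s : ℕ) : Set (MvPolynomial (Fin 3) K) :=
  let u := X 0; let v := X 1; let t := X 2
  {u ^ (k + 1), v ^ (s + 1), t ^ 2, u * v, u * t, v * t}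

/-- The relations of `K[A, B, C, S₁, S₂, S₃]` for the three-simples class. -/
def threeRels (a b c : ℕ) : Set (MvPolynomial (Fin 6) K) :=
  let A := X 0; let B := X 1; let C := X 2; let S₁ := X 3; let S₂ := X 4; let S₃ := X 5
  {A ^ (a + 1), B ^ (b + 1), C ^ (c + 1), A ^ a - S₂ - S₃, B ^ b - S₃ - S₁, C ^ c - S₁ - S₂,
    A * S₁, A * S₂, A * S₃, B * S₁, B * S₂, B * S₃, C * S₁, C * S₂, C * S₃,
    S₁ * S₁, S₁ * S₂, S₁ * S₃, S₂ * S₂, S₂ * S₃, S₃ * S₃, A * B, A * C, B * C}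

variable (R : Type v) [Ring R] [Algebra K R]

/-- `R` is an algebra of type `A₁^l`. -/
structure IsTypeOne (l : ℕ) : Prop where
  symmetric : IsSymmetricAlgebra K R
  indecomposable : IsIndecomposable R
  basic : IsBasic K R
  finrank_eq : Module.finrank K R = 4 * l
  centre_of_char_two : CharP K 2 → HasCentreAndReynolds K R (oneRelsCharTwo K l) {X 1}
  centre_of_char_ne_two : ¬ CharP K 2 → HasCentreAndReynolds K R (oneRels K l) {X 0 ^ l}

/-- `R` is an algebra of type `A₂^{k,s}`. -/
structure IsTypeTwo (k s : ℕ) : Prop where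
  symmetric : IsSymmetricAlgebra K R
  indecomposable : IsIndecomposable R
  basic : IsBasic K R
  cartan : HasCartanMatrix K R !![4 * k, 2 * k; 2 * k, s + k]
  centre_of_char_two : CharP K 2 → HasCentreAndReynolds K R (twoRelsCharTwo K k s) {X 0 ^ k, X 2}
  centre_of_char_ne_two :
    ¬ CharP K 2 → HasCentreAndReynolds K R (twoRels K k s) {X 0 ^ k, X 1 ^ s}

/-- `R` is an algebra of type `A₃^{a,b,c}`. In characteristic different from `2` the span of
`S₁, S₂, S₃` is also the span of `A ^ a, B ^ b, C ^ c`. -/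
structure IsTypeThree (a b c : ℕ) : Prop where
  symmetric : IsSymmetricAlgebra K R
  indecomposable : IsIndecomposable R
  basic : IsBasic K R
  cartan : HasCartanMatrix K R !![a + b, a, b; a, a + c, c; b, c, b + c]
  centre : HasCentreAndReynolds K R (threeRels K a b c) {X 3, X 4, X 5}

end Classes

end StableMorita

/-!
A stable equivalence of Morita type from `A` to `B` forces `det C_A ∣ det C_B`, where `C_A` and
`C_B` are the Cartan matrices: tensoring with the bimodules gives integer matrices with
`m n = 1 + C_A p` and `m C_B = C_A m'`. It also identifies `Z(A) / R(A)` with `Z(B) / R(B)`, by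
means of transfer maps between the algebras. For the three classes this quotient is
`K[x₀, x₁, x₂] / (xᵢ ^ pᵢ, xᵢ xⱼ)`, and the dimensions of the powers of its nilradical determine
`p₀ p₁ p₂`. The ratio of the Cartan determinant to `p₀ p₁ p₂` is `4` for `A₃`, `2` for `A₂` and
`1` for `A₁`, and an equivalence can only lead from a ratio to a multiple of it.
-/

namespace StableMorita

section LinearAlgebra

variable {K : Type*} [Field K] {V W : Type*} [AddCommGroup V] [Module K V] [AddCommGroup W]
  [Module K W]

theorem finrank_range_eq_sum [FiniteDimensional K W] {τ : Type*} [Fintype τ] [DecidableEq τ]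
    {p : Module.End K V} {q : τ → Module.End K W} (a : τ → W →ₗ[K] V) (b : τ → V →ₗ[K] W)
    (hp : ∀ v, ∑ t, a t (q t (b t v)) = p v)
    (hq : ∀ s t w, q t (b t (a s (q s w))) = if s = t then q s w else 0) :
    Module.finrank K (LinearMap.range p) = ∑ t, Module.finrank K (LinearMap.range (q t)) := by
  have split : ∀ y : ∀ t, LinearMap.range (q t), ∀ t, q t (b t (∑ s, a s (y s))) = y t := by
    intro y t
    choose w hw using fun s => (y s).2
    simp only [← hw, map_sum, hq, Finset.sum_ite_eq', Finset.mem_univ, if_true]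
  have mem : ∀ y : ∀ t, LinearMap.range (q t), p (∑ s, a s (y s)) = ∑ s, a s (y s) := fun y => by
    rw [← hp]
    exact Finset.sum_congr rfl fun t _ => by rw [split]
  let f : LinearMap.range p →ₗ[K] ∀ t, LinearMap.range (q t) :=
    LinearMap.pi fun t => (q t).rangeRestrict ∘ₗ b t ∘ₗ (LinearMap.range p).subtype
  let g : (∀ t, LinearMap.range (q t)) →ₗ[K] LinearMap.range p :=
    (∑ t, a t ∘ₗ (LinearMap.range (q t)).subtype ∘ₗ LinearMap.proj t).codRestrict _
      fun y => ⟨∑ s, a s (y s), by simpa using mem y⟩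
  have coe_g : ∀ y, (g y : V) = ∑ s, a s (y s) := fun y => by
    change (∑ t, a t ∘ₗ (LinearMap.range (q t)).subtype ∘ₗ LinearMap.proj t) y = _
    simp
  have gf : g ∘ₗ f = LinearMap.id := by
    refine LinearMap.ext fun ⟨_, v, rfl⟩ => Subtype.ext ?_
    have := mem fun t => ⟨_, b t v, rfl⟩
    rw [hp] at this
    exact (coe_g _).trans ((hp _).trans this)
  have fg : f ∘ₗ g = LinearMap.id := by
    refine LinearMap.ext fun y => funext fun t => Subtype.ext ?_
    exact (congrArg (fun v => q t (b t v)) (coe_g y)).trans (split y t)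
  rw [(LinearEquiv.ofLinearMap f g fg gf).finrank_eq, Module.finrank_pi_fintype]

end LinearAlgebra

/-- `D m'` and `m n` are related to `C` as the Cartan matrices of stably equivalent algebras are,
see `StablyEquivalentOfMoritaType.det_cartan_dvd`. -/
theorem det_dvd_det {R α β : Type*} [CommRing R] [Fintype α] [Fintype β] [DecidableEq α]
    [DecidableEq β] {C p : Matrix α α R} {D : Matrix β β R} {m m' : Matrix α β R}
    {n : Matrix β α R} (h : m * D = C * m') (h' : m * n = 1 + C * p) : C.det ∣ D.det := by
  have blocks_eq : Matrix.fromBlocks D (-n) 0 1 =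
      Matrix.fromBlocks 1 0 (-m) C * Matrix.fromBlocks D (-n) m' (-p) := by
    rw [Matrix.fromBlocks_multiply]
    simp [h, h']
  have := congrArg Matrix.det blocks_eq
  rw [Matrix.det_mul, Matrix.det_fromBlocks_zero₂₁, Matrix.det_fromBlocks_zero₁₂] at this
  simp only [Matrix.det_one, mul_one, one_mul] at this
  exact ⟨_, this⟩

/-! ### Dual bases and traces -/

section DualBases

/-- A finite dual basis of the module `V`. It exists if and only if `V` is finitely generated
projective. -/
structure DualBasis (R V ι : Type*) [Ring R] [AddCommGroup V] [Module R V] [Fintype ι] where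
  vec : ι → V
  coord : ι → V →ₗ[R] R
  sum_coord_smul : ∀ v, ∑ i, coord i v • vec i = v

theorem DualBasis.nonempty (R V : Type*) [Ring R] [AddCommGroup V] [Module R V]
    [Module.Finite R V] [Module.Projective R V] : ∃ r : ℕ, Nonempty (DualBasis R V (Fin r)) := by
  obtain ⟨r, f, g, -, -, h⟩ := Module.Finite.exists_comp_eq_id_of_projective R V
  refine ⟨r, ⟨⟨fun i => f (Pi.single i 1), fun i => LinearMap.proj i ∘ₗ g, fun v => ?_⟩⟩⟩
  calc ∑ i, g v i • f (Pi.single i 1) = f (∑ i, g v i • Pi.single i 1) := by simp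
    _ = f (g v) := by simp only [← Pi.single_smul, smul_eq_mul, mul_one, Finset.univ_sum_single]
    _ = v := LinearMap.congr_fun h v

variable {K : Type*} [Field K] {R : Type*} [Ring R] [Algebra K R]

/-- A linear form that vanishes on commutators. -/
def IsTraceForm (τ : R →ₗ[K] K) : Prop := ∀ a b, τ (a * b) = τ (b * a)

namespace DualBasis

variable {V V' ι κ : Type*} [AddCommGroup V] [Module R V] [AddCommGroup V'] [Module R V']
  [Fintype ι] [Fintype κ]

/-- The Hattori–Stallings trace of an endomorphism of `V`. It depends on the dual basis, but
its class modulo commutators does not. -/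
def tr (D : DualBasis R V ι) (h : Module.End R V) : R := ∑ i, D.coord i (h (D.vec i))

theorem apply_eq_sum (D : DualBasis R V ι) (h : V →ₗ[R] V') (v : V) :
    h v = ∑ i, D.coord i v • h (D.vec i) := by
  conv_lhs => rw [← D.sum_coord_smul v]
  simp

theorem tr_comm (D : DualBasis R V ι) (D' : DualBasis R V' κ) {τ : R →ₗ[K] K}
    (hτ : IsTraceForm τ) (g : V →ₗ[R] V') (k : V' →ₗ[R] V) :
    τ (D.tr (k ∘ₗ g)) = τ (D'.tr (g ∘ₗ k)) := by
  calc τ (D.tr (k ∘ₗ g)) = ∑ i, ∑ j, τ (D'.coord j (g (D.vec i)) * D.coord i (k (D'.vec j))) := by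
        simp only [tr, map_sum, LinearMap.comp_apply]
        refine Finset.sum_congr rfl fun i _ => ?_
        rw [D'.apply_eq_sum k (g (D.vec i))]
        simp
    _ = ∑ j, ∑ i, τ (D.coord i (k (D'.vec j)) * D'.coord j (g (D.vec i))) := by
        rw [Finset.sum_comm]
        exact Finset.sum_congr rfl fun j _ => Finset.sum_congr rfl fun i _ => hτ _ _
    _ = τ (D'.tr (g ∘ₗ k)) := by
        simp only [tr, map_sum, LinearMap.comp_apply]
        refine Finset.sum_congr rfl fun j _ => ?_
        rw [D.apply_eq_sum g (k (D'.vec j))]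
        simp

omit [Algebra K R] in
theorem map_tr_eq_zero (D : DualBasis R V ι) (π : R →+* K) {h : Module.End R V}
    (hh : IsNilpotent h) : π (D.tr h) = 0 := by
  classical
  obtain ⟨N, hN⟩ := hh
  -- The matrix of an endomorphism, transposed so that the coordinates need not commute.
  let T : Module.End R V → Matrix ι ι K := fun g => .of fun i j => π (D.coord j (g (D.vec i)))
  have T_mul : ∀ g g', T (g * g') = T g' * T g := fun g g' => by
    ext i j
    simp only [T, Matrix.of_apply, Matrix.mul_apply, Module.End.mul_apply, ← map_mul, ← map_sum]
    rw [D.apply_eq_sum g (g' (D.vec i))]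
    simp
  have T_pow : ∀ n, T (h ^ (n + 1)) = T h ^ (n + 1) := fun n => by
    induction n with
    | zero => simp
    | succ n ih => rw [pow_succ, T_mul, ih, ← pow_succ']
  have nil : IsNilpotent (T h) := by
    refine ⟨N + 1, ?_⟩
    rw [← T_pow, pow_succ, hN, zero_mul]
    ext
    simp [T]
  have trace : (T h).trace = π (D.tr h) := by simp [T, tr, Matrix.trace]
  rw [← trace]
  exact (Matrix.isNilpotent_trace_of_isNilpotent nil).eq_zero

end DualBasis

end DualBases

/-! ### Split basic algebras and their projective modules -/

section SplitIdempotents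

variable {K : Type*} [Field K] {R : Type*} [Ring R] [Algebra K R] {R' : Type*} [Ring R']
  [Algebra K R'] {ι ι' : Type*} [Fintype ι'] [DecidableEq ι'] [Fintype ι] [DecidableEq ι]

/-- A complete set of orthogonal idempotents `e i` of a split basic algebra, together with the
characters `π i` dual to them. That the characters are all the simple modules is encoded by the
nilpotency of the elements that they annihilate. -/
structure SplitIdempotents (K : Type*) [Field K] (R : Type*) [Ring R] [Algebra K R] (ι : Type*)
    [Fintype ι] [DecidableEq ι] where
  e : ι → R
  complete : CompleteOrthogonalIdempotents e
  π : ι → R →ₐ[K] K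
  π_e : ∀ i j, π i (e j) = if i = j then 1 else 0
  nil : ∀ a, (∀ i, π i a = 0) → IsNilpotent a

theorem isNilpotent_of_mem_jacobson (K : Type*) [Field K] [Algebra K R] [FiniteDimensional K R]
    {a : R} (ha : a ∈ Ring.jacobson R) : IsNilpotent a := by
  have : IsArtinianRing R := isArtinian_of_tower K inferInstance
  obtain ⟨k, hk⟩ := IsSemiprimaryRing.isNilpotent (R := R)
  exact ⟨k, by simpa [hk] using Ideal.pow_mem_pow ha k⟩

open Algebra.TensorProduct in
theorem isNilpotent_of_mem_jacobson_mul [FiniteDimensional K R] {x : R ⊗[K] R'}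
    (hx : x ∈ ((Ring.jacobson R).restrictScalars K).map includeLeft.toLinearMap *
      LinearMap.range (includeRight (R := K) (A := R) (B := R')).toLinearMap) :
    IsNilpotent x := by
  have : IsArtinianRing R := isArtinian_of_tower K inferInstance
  set L := ((Ring.jacobson R).restrictScalars K).map
    (includeLeft (R := K) (S := K) (A := R) (B := R')).toLinearMap
  set T := LinearMap.range (includeRight (R := K) (A := R) (B := R')).toLinearMap
  have swap : ∀ (a : R) (b : R'), (a ⊗ₜ[K] 1) * (1 ⊗ₜ[K] b) = (1 ⊗ₜ[K] b) * (a ⊗ₜ[K] 1) := by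
    simp
  have comm : Commute L T := by
    refine le_antisymm (Submodule.mul_le.mpr ?_) (Submodule.mul_le.mpr ?_)
    · rintro _ ⟨a, ha, rfl⟩ _ ⟨b, rfl⟩
      exact swap a b ▸ Submodule.mul_mem_mul (M := T) (N := L) ⟨b, rfl⟩ ⟨a, ha, rfl⟩
    · rintro _ ⟨b, rfl⟩ _ ⟨a, ha, rfl⟩
      exact swap a b ▸ Submodule.mul_mem_mul (M := L) (N := T) ⟨a, ha, rfl⟩ ⟨b, rfl⟩
  obtain ⟨N, hN⟩ := IsSemiprimaryRing.isNilpotent (R := R)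
  have nil : L ^ (N + 1) = ⊥ := by
    rw [← Submodule.map_pow, ← Submodule.restrictScalars_pow N.succ_ne_zero, Submodule.pow_succ]
    simp [hN]
  refine ⟨N + 1, ?_⟩
  have := Submodule.pow_mem_pow _ hx (N + 1)
  rwa [comm.mul_pow, nil, Submodule.bot_mul, Submodule.mem_bot] at this

namespace SplitIdempotents

theorem mul_e_self (S : SplitIdempotents K R ι) (i : ι) : S.e i * S.e i = S.e i :=
  (S.complete.idem i).eq

theorem mem_jacobson (S : SplitIdempotents K R ι) {a : R} (ha : ∀ i, S.π i a = 0) :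
    a ∈ Ring.jacobson R := by
  rw [← Ideal.jacobson_bot, Ideal.mem_jacobson_iff]
  intro y
  have hn : IsNilpotent (y * a) := S.nil _ fun i => by simp [ha i]
  obtain ⟨u, hu⟩ := hn.isUnit_one_add
  refine ⟨↑u⁻¹, ?_⟩
  have : (↑u⁻¹ : R) * (1 + y * a) = 1 := by rw [← hu]; simp
  rw [Ideal.mem_bot, mul_assoc, ← this]
  noncomm_ring

/-- The idempotents and characters of the opposite algebra. -/
def op (S : SplitIdempotents K R ι) : SplitIdempotents K Rᵐᵒᵖ ι where
  e i := MulOpposite.op (S.e i)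
  complete :=
    { idem := fun i => by rw [IsIdempotentElem, ← MulOpposite.op_mul, S.mul_e_self]
      ortho := fun i j hij => by
        change MulOpposite.op (S.e i) * MulOpposite.op (S.e j) = 0
        rw [← MulOpposite.op_mul, S.complete.ortho hij.symm, MulOpposite.op_zero]
      complete := by
        rw [← MulOpposite.op_one, ← S.complete.complete]
        exact (map_sum MulOpposite.opAddEquiv _ _).symm }
  π i := (S.π i).fromOpposite fun _ _ => Commute.all _ _
  π_e := S.π_e
  nil a ha := by
    obtain ⟨N, hN⟩ := S.nil a.unop ha
    exact ⟨N, MulOpposite.unop_injective (by simpa using hN)⟩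

@[simp]
theorem op_e (S : SplitIdempotents K R ι) (i : ι) : S.op.e i = MulOpposite.op (S.e i) := rfl

/-- The character `π i` applied to the left factor of `R ⊗ R'`. -/
noncomputable def contract (S : SplitIdempotents K R ι) (R' : Type*) [Ring R'] [Algebra K R']
    (i : ι) : R ⊗[K] R' →ₐ[K] R' :=
  (Algebra.TensorProduct.lid K R').toAlgHom.comp
    (Algebra.TensorProduct.map (S.π i) (AlgHom.id K R'))

@[simp]
theorem contract_tmul (S : SplitIdempotents K R ι) (i : ι) (a : R) (b : R') :
    S.contract R' i (a ⊗ₜ b) = S.π i a • b := by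
  simp [contract]

open Algebra.TensorProduct in
theorem isNilpotent_of_contract_eq_zero [FiniteDimensional K R] (S : SplitIdempotents K R ι)
    {x : R ⊗[K] R'} (hx : ∀ i, S.contract R' i x = 0) : IsNilpotent x := by
  refine isNilpotent_of_mem_jacobson_mul ?_
  have decomp : ∀ y : R ⊗[K] R', y - ∑ i, S.e i ⊗ₜ S.contract R' i y ∈
      ((Ring.jacobson R).restrictScalars K).map includeLeft.toLinearMap *
        LinearMap.range (includeRight (R := K) (A := R) (B := R')).toLinearMap := by
    intro y
    induction y with
    | zero => simp
    | tmul a b =>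
      have : a ⊗ₜ b - ∑ i, S.e i ⊗ₜ[K] S.contract R' i (a ⊗ₜ b) =
          ((a - ∑ i, S.π i a • S.e i) ⊗ₜ[K] (1 : R')) * ((1 : R) ⊗ₜ[K] b) := by
        simp [sub_mul, Finset.sum_mul, TensorProduct.sub_tmul, TensorProduct.sum_tmul,
          TensorProduct.smul_tmul']
      rw [this]
      exact Submodule.mul_mem_mul ⟨_, S.mem_jacobson fun i => by simp [S.π_e], rfl⟩ ⟨b, rfl⟩
    | add y z hy hz =>
      convert Submodule.add_mem _ hy hz using 1
      simp only [map_add, TensorProduct.tmul_add, Finset.sum_add_distrib]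
      abel
  simpa [hx] using decomp x

/-- The idempotents `e i ⊗ e j` and the characters of a tensor product. -/
noncomputable def tensor [FiniteDimensional K R] (S : SplitIdempotents K R ι)
    (S' : SplitIdempotents K R' ι') : SplitIdempotents K (R ⊗[K] R') (ι × ι') where
  e i := S.e i.1 ⊗ₜ S'.e i.2
  complete :=
    { idem := fun i => by
        simp [IsIdempotentElem, S.mul_e_self, S'.mul_e_self]
      ortho := by
        rintro ⟨i, i'⟩ ⟨j, j'⟩ hij
        obtain h | h : i ≠ j ∨ i' ≠ j' := by
          by_contra! h
          exact hij (Prod.ext h.1 h.2)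
        · simp [S.complete.ortho h]
        · simp [S'.complete.ortho h]
      complete := by
        simp only [Fintype.sum_prod_type, ← TensorProduct.tmul_sum, ← TensorProduct.sum_tmul,
          S.complete.complete, S'.complete.complete, Algebra.TensorProduct.one_def] }
  π i := (S'.π i.2).comp (S.contract R' i.1)
  π_e i j := by
    simp only [AlgHom.comp_apply, contract_tmul, map_smul, S.π_e, S'.π_e, Prod.ext_iff, ite_and,
      smul_eq_mul, ite_mul, one_mul, zero_mul]
  nil x hx := by
    choose n hn using fun i => S'.nil (S.contract R' i x) fun j => hx (i, j)
    obtain ⟨N, hN⟩ := S.isNilpotent_of_contract_eq_zero (x := x ^ ∑ i, n i) fun i => by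
      rw [map_pow]
      exact pow_eq_zero_of_le (Finset.single_le_sum (fun _ _ => Nat.zero_le _)
        (Finset.mem_univ i)) (hn i)
    exact ⟨_, by rwa [← pow_mul] at hN⟩

@[simp]
theorem tensor_e [FiniteDimensional K R] (S : SplitIdempotents K R ι)
    (S' : SplitIdempotents K R' ι') (i : ι × ι') :
    (S.tensor S').e i = S.e i.1 ⊗ₜ S'.e i.2 := rfl

end SplitIdempotents

end SplitIdempotents

section IdempotentBasis

variable {K : Type*} [Field K] {R : Type*} [Ring R] [Algebra K R] {ι : Type*} [Fintype ι]
  [DecidableEq ι] {V : Type*} [AddCommGroup V] [Module R V]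

/-- A decomposition of the direct summand `ε V` of a projective module `V` into modules
`R e (label t)`, presented by generators and coordinate functions. -/
structure IdempotentBasis (e : ι → R) (ε : Module.End R V) (r : ℕ) where
  /-- The idempotent that generates a module isomorphic to the `t`-th summand. -/
  label : Fin r → ι
  vec : Fin r → V
  coord : Fin r → V →ₗ[R] R
  sum_coord_smul : ∀ v, ∑ t, coord t v • vec t = ε v
  coord_vec : ∀ s t, coord t (vec s) = if s = t then e (label t) else 0
  e_smul_vec : ∀ t, e (label t) • vec t = vec t
  coord_apply : ∀ t v, coord t (ε v) = coord t v

namespace IdempotentBasis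

/-- The number of summands isomorphic to `R e i`. -/
def mult {e : ι → R} {ε : Module.End R V} {r : ℕ} (D : IdempotentBasis e ε r) (i : ι) : ℕ :=
  Finset.card {t | D.label t = i}

theorem sum_label {e : ι → R} {ε : Module.End R V} {r : ℕ} (D : IdempotentBasis e ε r)
    (d : ι → ℕ) : ∑ t, d (D.label t) = ∑ i, D.mult i * d i := by
  simp only [mult, Finset.card_filter, Finset.sum_mul, ite_mul, one_mul, zero_mul]
  rw [Finset.sum_comm]
  simp

theorem finrank_range [Module K V] [IsScalarTower K R V] [FiniteDimensional K R] {e : ι → R}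
    {ε : Module.End R V} {r : ℕ} (D : IdempotentBasis e ε r) (he : ∀ i, e i * e i = e i) {f : R}
    (hf : f * f = f) :
    Module.finrank K (LinearMap.range (Algebra.lsmul K K V f ∘ₗ ε.restrictScalars K)) =
      ∑ i, D.mult i * Module.finrank K (peirce K f (e i)) := by
  rw [← D.sum_label]
  refine finrank_range_eq_sum
    (q := fun t => LinearMap.mulLeft K f ∘ₗ LinearMap.mulRight K (e (D.label t)))
    (fun t => LinearMap.toSpanSingleton R V (D.vec t) |>.restrictScalars K)
    (fun t => (D.coord t).restrictScalars K) (fun v => ?_) fun s t x => ?_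
  · simp [mul_smul, D.e_smul_vec, ← D.sum_coord_smul, Finset.smul_sum]
  · rcases eq_or_ne s t with rfl | h
    · simp [D.coord_vec, mul_assoc, he, ← mul_assoc f f, hf]
    · simp [D.coord_vec, h]

end IdempotentBasis

variable [Module.Finite R V] [Module.Projective R V]

/-- Nakayama's lemma yields a coordinate function that is not radical on `ε V`; its value is a unit
in the local ring `e k R e k` for a suitable `k`. -/
theorem SplitIdempotents.exists_split_generator (S : SplitIdempotents K R ι) {ε : Module.End R V}
    (hε : IsIdempotentElem ε) (h0 : ε ≠ 0) :
    ∃ (k : ι) (x : V) (f : V →ₗ[R] R), f x = S.e k ∧ ε x = x ∧ S.e k • x = x ∧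
      (∀ v, f (ε v) = f v) ∧ ∀ v, f v * S.e k = f v := by
  have εε : ∀ v, ε (ε v) = ε v := fun v => LinearMap.congr_fun hε.eq v
  obtain ⟨r, ⟨D⟩⟩ := DualBasis.nonempty R V
  obtain ⟨i, v, k, hk⟩ : ∃ i v k, S.π k (D.coord i (ε v)) ≠ 0 := by
    by_contra! h
    refine h0 (LinearMap.range_eq_bot.mp (Submodule.FG.eq_bot_of_le_jacobson_smul
      (LinearMap.range_eq_map ε ▸ Module.Finite.fg_top.map ε) ?_))
    rintro _ ⟨v, rfl⟩
    rw [← εε, D.apply_eq_sum ε]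
    exact Submodule.sum_mem _ fun i _ =>
      Submodule.smul_mem_smul (S.mem_jacobson (h i v)) ⟨_, rfl⟩
  let x : V := S.e k • algebraMap K R (S.π k (D.coord i (ε v)))⁻¹ • ε v
  have ex : S.e k • x = x := by simp only [x, smul_smul _ (S.e k), S.mul_e_self]
  let g : V →ₗ[R] R := LinearMap.toSpanSingleton R R (S.e k) ∘ₗ D.coord i ∘ₗ ε
  have e_g : S.e k * g x = g x := by rw [← smul_eq_mul, ← map_smul, ex]
  have g_e : ∀ v, g v * S.e k = g v := fun v => by simp [g, mul_assoc, S.mul_e_self]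
  have nil : IsNilpotent (g x - S.e k) := by
    refine S.nil _ fun j => ?_
    rcases eq_or_ne j k with rfl | h
    · simp [g, x, εε, S.π_e, hk]
    · simp [g, x, εε, S.π_e, h]
  obtain ⟨u, hu⟩ := nil.isUnit_one_add
  have comm : S.e k * u = u * S.e k := by
    rw [hu]
    simp [mul_add, add_mul, mul_sub, sub_mul, e_g, g_e]
  have comm' : (↑u⁻¹ : R) * S.e k = S.e k * ↑u⁻¹ := by
    rw [Units.inv_mul_eq_iff_eq_mul, ← mul_assoc, ← comm, mul_assoc, Units.mul_inv, mul_one]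
  refine ⟨k, x, LinearMap.toSpanSingleton R R ↑u⁻¹ ∘ₗ g, ?_, ?_, ex, ?_, ?_⟩
  · have : g x = S.e k * u := by simp [hu, mul_add, mul_sub, S.mul_e_self, e_g]
    simp [this, mul_assoc]
  · simp [x, εε]
  · simp [g, εε]
  · simp [mul_assoc, comm', ← mul_assoc (g _), g_e]

omit [Module.Finite R V] [Module.Projective R V] in
/-- Splitting off a summand `R e k` generated by `x` with coordinate function `f`. -/
def IdempotentBasis.cons {e : ι → R} {ε ε' : Module.End R V} {r : ℕ}
    (D : IdempotentBasis e ε' r) {k : ι} {x : V} {f : V →ₗ[R] R}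
    (hε : IsIdempotentElem ε) (hε' : ∀ v, ε' v = ε v - f v • x) (fx : f x = e k) (εx : ε x = x)
    (ex : e k • x = x) (fε : ∀ v, f (ε v) = f v) (fe : ∀ v, f v * e k = f v) :
    IdempotentBasis e ε (r + 1) :=
  have ε'_vec : ∀ t, ε' (D.vec t) = D.vec t := fun t => by
    rw [← D.sum_coord_smul]
    simp [D.coord_vec, D.e_smul_vec]
  have ε'x : ε' x = 0 := by simp [hε', εx, fx, ex]
  have fε' : ∀ v, f (ε' v) = 0 := fun v => by simp [hε', fε, fx, fe]
  have ε'ε : ∀ v, ε' (ε v) = ε' v := fun v => by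
    rw [hε', hε', fε, ← Module.End.mul_apply, hε.eq]
  { label := Fin.cons k D.label
    vec := Fin.cons x D.vec
    coord := Fin.cons f D.coord
    sum_coord_smul := fun v => by simp [Fin.sum_univ_succ, D.sum_coord_smul, hε']
    coord_vec := fun s t => by
      cases s using Fin.cases with
      | zero => cases t using Fin.cases with
        | zero => simpa using fx
        | succ t => simp [← D.coord_apply t x, ε'x, (Fin.succ_ne_zero _).symm]
      | succ s => cases t using Fin.cases with
        | zero =>
          simp only [Fin.cons_zero, Fin.cons_succ, Fin.succ_ne_zero, if_false]
          rw [← ε'_vec s, fε']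
        | succ t => simp [D.coord_vec]
    e_smul_vec := Fin.cases ex D.e_smul_vec
    coord_apply := Fin.cases fε fun t v => by
      simp only [Fin.cons_succ]
      rw [← D.coord_apply t (ε v), ε'ε, D.coord_apply] }

variable [Module K V] [IsScalarTower K R V] [FiniteDimensional K V]

theorem SplitIdempotents.nonempty_idempotentBasis (S : SplitIdempotents K R ι)
    {ε : Module.End R V} (hε : IsIdempotentElem ε) :
    ∃ r, Nonempty (IdempotentBasis S.e ε r) := by
  induction hd : Module.finrank K (LinearMap.range (ε.restrictScalars K)) using
    Nat.strong_induction_on generalizing ε with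
  | _ d ih =>
  by_cases h0 : ε = 0
  · exact ⟨0, ⟨⟨Fin.elim0, Fin.elim0, Fin.elim0, by simp [h0], fun t => t.elim0,
      fun t => t.elim0, fun t => t.elim0⟩⟩⟩
  obtain ⟨k, x, f, fx, εx, ex, fε, fe⟩ := S.exists_split_generator hε h0
  have εε : ∀ v, ε (ε v) = ε v := fun v => LinearMap.congr_fun hε.eq v
  let ε' : Module.End R V := ε - LinearMap.toSpanSingleton R V x ∘ₗ f
  have ε'_apply : ∀ v, ε' v = ε v - f v • x := fun v => by simp [ε']
  have εε' : ∀ v, ε (ε' v) = ε' v := fun v => by simp [ε'_apply, εε, εx]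
  have ε'ε' : ∀ v, ε' (ε' v) = ε' v := fun v => by
    rw [ε'_apply (ε' v), εε']
    simp [ε'_apply, fε, fx, fe]
  have lt : LinearMap.range (ε'.restrictScalars K) < LinearMap.range (ε.restrictScalars K) := by
    refine lt_of_le_of_ne (by rintro _ ⟨v, rfl⟩; exact ⟨ε' v, εε' v⟩) fun h => ?_
    obtain ⟨v, hv⟩ : x ∈ LinearMap.range (ε'.restrictScalars K) := h ▸ ⟨x, εx⟩
    have hx : x = 0 := by
      calc x = ε' (ε' v) := hv.symm.trans (ε'ε' v).symm
        _ = ε' x := congrArg ε' hv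
        _ = 0 := by simp [ε'_apply, εx, fx, ex]
    have := congrArg (S.π k) fx
    simp [hx, S.π_e] at this
  obtain ⟨r, ⟨D⟩⟩ := ih _ (hd ▸ Submodule.finrank_lt_finrank_of_lt lt) (LinearMap.ext ε'ε') rfl
  exact ⟨r + 1, ⟨D.cons hε ε'_apply fx εx ex fε fe⟩⟩

end IdempotentBasis

/-! ### Tensor products of bimodules -/

section Tensor

variable {K : Type u} [Field K] {A : Type v} [Ring A] [Algebra K A] {B : Type w} [Ring B]
  [Algebra K B]

instance (M : Bimodule K A B) : SMulCommClass Bᵐᵒᵖ A M.carrier := SMulCommClass.symm _ _ _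

namespace Bimodule

/-- The canonical bilinear map into `M ⊗[B] N`. -/
def balancedMk (M : Bimodule K A B) (N : Bimodule K B A) :
    M.carrier →ₗ[K] N.carrier →ₗ[K] BalancedTensor M N :=
  (TensorProduct.mk K M.carrier N.carrier).compr₂ (balancingSubmodule M N).mkQ

variable {M : Bimodule K A B} {N : Bimodule K B A} {W : Type*} [AddCommGroup W] [Module K W]

theorem balanced_ext {f g : BalancedTensor M N →ₗ[K] W}
    (h : ∀ m n, f (balancedMk M N m n) = g (balancedMk M N m n)) : f = g :=
  Submodule.linearMap_qext _ (TensorProduct.ext' h)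

theorem balancedMk_op_smul (m : M.carrier) (b : B) (n : N.carrier) :
    balancedMk M N (MulOpposite.op b • m) n = balancedMk M N m (b • n) := by
  refine sub_eq_zero.mp (((balancingSubmodule M N).mkQ.map_sub _ _).symm.trans ?_)
  exact (Submodule.Quotient.mk_eq_zero _).mpr (Submodule.subset_span ⟨m, b, n, rfl⟩)

/-- The linear map out of `M ⊗[B] N` given by a balanced bilinear map. -/
def balancedLift (f : M.carrier →ₗ[K] N.carrier →ₗ[K] W)
    (hf : ∀ m (b : B) n, f (MulOpposite.op b • m) n = f m (b • n)) :
    BalancedTensor M N →ₗ[K] W :=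
  (balancingSubmodule M N).liftQ (TensorProduct.lift f) (by
    rw [balancingSubmodule, Submodule.span_le]
    rintro _ ⟨m, b, n, rfl⟩
    simp [hf])

@[simp]
theorem balancedLift_mk (f : M.carrier →ₗ[K] N.carrier →ₗ[K] W)
    (hf : ∀ m (b : B) n, f (MulOpposite.op b • m) n = f m (b • n)) (m : M.carrier)
    (n : N.carrier) : balancedLift f hf (balancedMk M N m n) = f m n := by
  simp [balancedLift, balancedMk]

/-- The endomorphism `m ⊗ n ↦ f m ⊗ g n`. -/
def balancedMap (f : Module.End Bᵐᵒᵖ M.carrier) (g : Module.End B N.carrier) :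
    Module.End K (BalancedTensor M N) :=
  balancedLift ((balancedMk M N).compl₁₂ (f.restrictScalars K) (g.restrictScalars K))
    fun m b n => by simp [balancedMk_op_smul]

@[simp]
theorem balancedMap_mk (f : Module.End Bᵐᵒᵖ M.carrier) (g : Module.End B N.carrier)
    (m : M.carrier) (n : N.carrier) :
    balancedMap f g (balancedMk M N m n) = balancedMk M N (f m) (g n) :=
  balancedLift_mk _ _ m n

variable (M N)

/-- The action of `A` on the left factor of `M ⊗[B] N`. -/
def balancedLeft : A →ₐ[K] Module.End K (BalancedTensor M N) :=
  .ofLinearMap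
    { toFun := fun a => balancedMap (Algebra.lsmul K Bᵐᵒᵖ M.carrier a) 1
      map_add' := fun a a' => balanced_ext fun m n => by simp
      map_smul' := fun c a => balanced_ext fun m n => by simp }
    (balanced_ext fun m n => by simp) fun a a' => balanced_ext fun m n => by simp

/-- The right action of `A` on the right factor of `M ⊗[B] N`. -/
def balancedRight : Aᵐᵒᵖ →ₐ[K] Module.End K (BalancedTensor M N) :=
  .ofLinearMap
    { toFun := fun a => balancedMap 1 (Algebra.lsmul K B N.carrier a)
      map_add' := fun a a' => balanced_ext fun m n => by simp
      map_smul' := fun c a => balanced_ext fun m n => by simp }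
    (balanced_ext fun m n => by simp) fun a a' => balanced_ext fun m n => by simp

/-- The bimodule `M ⊗[B] N`. -/
def tensor : Bimodule K A A :=
  letI := Module.compHom (BalancedTensor M N) (balancedLeft M N).toRingHom
  letI := Module.compHom (BalancedTensor M N) (balancedRight M N).toRingHom
  { carrier := BalancedTensor M N
    leftTower := ⟨fun c a x => LinearMap.congr_fun (map_smul (balancedLeft M N) c a) x⟩
    rightTower := ⟨fun c a x => LinearMap.congr_fun (map_smul (balancedRight M N) c a) x⟩
    comm := ⟨fun a a' => LinearMap.congr_fun (f := balancedLeft M N a * balancedRight M N a')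
      (g := balancedRight M N a' * balancedLeft M N a) (balanced_ext fun m n => by
        simp [balancedLeft, balancedRight])⟩ }

/-- The canonical bilinear map `(m, n) ↦ m ⊗ n`. -/
def tmul : M.carrier →ₗ[K] N.carrier →ₗ[K] (M.tensor N).carrier :=
  balancedMk M N

variable {M N}

theorem tensor_ext {f g : (M.tensor N).carrier →ₗ[K] W}
    (h : ∀ m n, f (tmul M N m n) = g (tmul M N m n)) : f = g :=
  balanced_ext h

theorem op_smul_tmul (m : M.carrier) (b : B) (n : N.carrier) :
    tmul M N (MulOpposite.op b • m) n = tmul M N m (b • n) :=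
  balancedMk_op_smul m b n

@[simp]
theorem smul_tmul (a : A) (m : M.carrier) (n : N.carrier) :
    a • tmul M N m n = tmul M N (a • m) n :=
  balancedMap_mk (Algebra.lsmul K Bᵐᵒᵖ M.carrier a) 1 m n

@[simp]
theorem tmul_op_smul (a : Aᵐᵒᵖ) (m : M.carrier) (n : N.carrier) :
    a • tmul M N m n = tmul M N m (a • n) :=
  balancedMap_mk 1 (Algebra.lsmul K B N.carrier a) m n

/-- The linear map out of `M ⊗[B] N` given by a balanced bilinear map. -/
def tensorLift (f : M.carrier →ₗ[K] N.carrier →ₗ[K] W)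
    (hf : ∀ m (b : B) n, f (MulOpposite.op b • m) n = f m (b • n)) :
    (M.tensor N).carrier →ₗ[K] W :=
  balancedLift f hf

@[simp]
theorem tensorLift_tmul (f : M.carrier →ₗ[K] N.carrier →ₗ[K] W)
    (hf : ∀ m (b : B) n, f (MulOpposite.op b • m) n = f m (b • n)) (m : M.carrier)
    (n : N.carrier) : tensorLift f hf (tmul M N m n) = f m n :=
  balancedLift_mk f hf m n

end Bimodule

theorem TensorIsoRegularSum.exists_equiv {M : Bimodule K A B} {N : Bimodule K B A}
    {P : Bimodule K A A} (h : TensorIsoRegularSum M N P) :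
    ∃ E : (M.tensor N).carrier ≃ₗ[A] A × P.carrier,
      ∀ (a : A) x, E (MulOpposite.op a • x) = MulOpposite.op a • E x := by
  obtain ⟨Φ, left, right⟩ := h
  let Ψ : (M.tensor N).carrier ≃ₗ[K] A × P.carrier := Φ
  have map_smul : ∀ (a : A) x, Ψ (a • x) = a • Ψ x := fun a => LinearMap.congr_fun
    (f := Ψ.toLinearMap ∘ₗ Algebra.lsmul K K _ a) (g := Algebra.lsmul K K _ a ∘ₗ Ψ.toLinearMap)
    (Bimodule.tensor_ext fun m n => by simpa using! left a m n)
  have map_op_smul : ∀ (a : A) x, Ψ (MulOpposite.op a • x) = MulOpposite.op a • Ψ x := fun a =>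
    LinearMap.congr_fun (f := Ψ.toLinearMap ∘ₗ Algebra.lsmul K K _ (MulOpposite.op a))
      (g := Algebra.lsmul K K _ (MulOpposite.op a) ∘ₗ Ψ.toLinearMap)
      (Bimodule.tensor_ext fun m n => by simpa using! right a m n)
  exact ⟨{ Ψ with map_smul' := map_smul }, map_op_smul⟩

end Tensor

/-! ### Cartan matrices -/

section Cartan

variable {K : Type u} [Field K] {A : Type v} [Ring A] [Algebra K A] {B : Type w} [Ring B]
  [Algebra K B]

theorem finrank_range_tensorProduct_map {V V' W W' : Type*} [AddCommGroup V] [Module K V]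
    [AddCommGroup V'] [Module K V'] [AddCommGroup W] [Module K W] [AddCommGroup W'] [Module K W']
    (f : V →ₗ[K] V') (g : W →ₗ[K] W') :
    Module.finrank K (LinearMap.range (TensorProduct.map f g)) =
      Module.finrank K (LinearMap.range f) * Module.finrank K (LinearMap.range g) := by
  have factor : TensorProduct.map f g =
      TensorProduct.mapIncl (LinearMap.range f) (LinearMap.range g) ∘ₗ
        TensorProduct.map f.rangeRestrict g.rangeRestrict := by
    rw [TensorProduct.mapIncl, ← TensorProduct.map_comp]
    simp
  rw [factor, LinearMap.range_comp_of_range_eq_top, LinearMap.finrank_range_of_inj,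
    Module.finrank_tensorProduct]
  · exact TensorProduct.map_injective_of_flat_flat _ _ (Submodule.subtype_injective _)
      (Submodule.subtype_injective _)
  · exact LinearMap.range_eq_top.mpr
      (TensorProduct.map_surjective f.surjective_rangeRestrict g.surjective_rangeRestrict)

theorem finrank_peirce_tmul (a a' : A) (b b' : B) :
    Module.finrank K (peirce K (a ⊗ₜ[K] b) (a' ⊗ₜ[K] b')) =
      Module.finrank K (peirce K a a') * Module.finrank K (peirce K b b') := by
  have : LinearMap.mulLeft K (a ⊗ₜ[K] b) ∘ₗ LinearMap.mulRight K (a' ⊗ₜ[K] b') =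
      TensorProduct.map (LinearMap.mulLeft K a ∘ₗ LinearMap.mulRight K a')
        (LinearMap.mulLeft K b ∘ₗ LinearMap.mulRight K b') :=
    TensorProduct.ext' fun x y => by simp
  rw [peirce, this, finrank_range_tensorProduct_map, peirce, peirce]

theorem finrank_peirce_op (a a' : A) :
    Module.finrank K (peirce K (MulOpposite.op a) (MulOpposite.op a')) =
      Module.finrank K (peirce K a' a) := by
  have : peirce K (MulOpposite.op a) (MulOpposite.op a') =
      (peirce K a' a).map (MulOpposite.opLinearEquiv K : A ≃ₗ[K] Aᵐᵒᵖ).toLinearMap := by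
    rw [peirce, peirce, ← LinearMap.range_comp,
      ← LinearMap.range_comp_of_range_eq_top _ (MulOpposite.opLinearEquiv K).range]
    congr 1
    ext
    simp [mul_assoc]
  rw [this]
  exact LinearEquiv.finrank_map_eq _ _

/-- The subspace `e V f` of a bimodule `V`. -/
def corner (K : Type*) [Field K] {A B : Type*} [Ring A] [Algebra K A] [Ring B] [Algebra K B]
    (V : Type*) [AddCommGroup V] [Module K V] [Module A V] [Module Bᵐᵒᵖ V]
    [IsScalarTower K A V] [IsScalarTower K Bᵐᵒᵖ V] (e : A) (f : B) : Submodule K V :=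
  LinearMap.range (Algebra.lsmul K K V e ∘ₗ Algebra.lsmul K K V (MulOpposite.op f))

namespace Bimodule

/-- The map `m ⊗ n ↦ f m • n` on `M ⊗[B] N` induced by a homomorphism `f : M → B` of right
modules. -/
def contractLeft {M : Bimodule K A B} (N : Bimodule K B A) (f : M.carrier →ₗ[Bᵐᵒᵖ] Bᵐᵒᵖ) :
    (M.tensor N).carrier →ₗ[K] N.carrier :=
  tensorLift
    (LinearMap.mk₂ K (fun m n => (f m).unop • n) (by simp [add_smul])
      (fun c m n => by
        rw [← LinearMap.coe_restrictScalars K f, map_smul, MulOpposite.unop_smul, smul_assoc])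
      (by simp) (fun c m n => smul_comm _ _ _))
    (fun m b n => by simp [mul_smul])

@[simp]
theorem contractLeft_tmul {M : Bimodule K A B} {N : Bimodule K B A}
    (f : M.carrier →ₗ[Bᵐᵒᵖ] Bᵐᵒᵖ) (m : M.carrier) (n : N.carrier) :
    contractLeft N f (tmul M N m n) = (f m).unop • n :=
  tensorLift_tmul _ _ m n

variable {ι ι' : Type*} [Fintype ι] [DecidableEq ι] [Fintype ι'] [DecidableEq ι']

theorem finrank_corner_tensor {M : Bimodule K A B} (N : Bimodule K B A)
    [FiniteDimensional K N.carrier] (S : SplitIdempotents K B ι) {e : A} {r : ℕ}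
    (D : IdempotentBasis S.op.e (Algebra.lsmul K Bᵐᵒᵖ M.carrier e) r) {f : A} (hf : f * f = f) :
    Module.finrank K (corner K (M.tensor N).carrier e f) =
      ∑ i, D.mult i * Module.finrank K (corner K N.carrier (S.e i) f) := by
  rw [← D.sum_label]
  refine finrank_range_eq_sum (fun t => tmul M N (D.vec t)) (fun t => contractLeft N (D.coord t))
    (fun v => ?_) fun s t n => ?_
  · have e_vec : ∀ t n, tmul M N (D.vec t) (S.e (D.label t) • n) = tmul M N (D.vec t) n :=
      fun t n => by
        rw [← op_smul_tmul]
        exact congrArg (tmul M N · n) (D.e_smul_vec t)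
    have expand : ∑ t, tmul M N (D.vec t) ∘ₗ contractLeft N (D.coord t) =
        Algebra.lsmul K K (M.tensor N).carrier e := tensor_ext fun m n => by
      simp only [LinearMap.sum_apply, LinearMap.comp_apply, contractLeft_tmul, ← op_smul_tmul,
        MulOpposite.op_unop, Algebra.lsmul_coe, smul_tmul]
      rw [← LinearMap.sum_apply, ← map_sum, D.sum_coord_smul, Algebra.lsmul_coe]
    simpa [e_vec, Finset.smul_sum, smul_comm e] using
      congrArg (MulOpposite.op f • ·) (LinearMap.congr_fun expand v)
  · rcases eq_or_ne s t with rfl | h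
    · simp [D.coord_vec, smul_comm (MulOpposite.op f) (S.e _), smul_smul, S.mul_e_self,
        ← MulOpposite.op_mul, hf]
    · simp [D.coord_vec, h]

end Bimodule

end Cartan

section DimMatrix

variable {K : Type u} [Field K] {A : Type v} [Ring A] [Algebra K A] {B : Type w} [Ring B]
  [Algebra K B] {ι ι' : Type*} [Fintype ι'] [DecidableEq ι'] [Fintype ι] [DecidableEq ι]

/-- The Cartan matrix, with integral entries. -/
noncomputable def SplitIdempotents.cartan (S : SplitIdempotents K A ι) : Matrix ι ι ℤ :=
  .of fun i j => Module.finrank K (peirce K (S.e i) (S.e j))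

namespace Bimodule

/-- The matrix of the dimensions of the subspaces `e i M e j`; for `M = A` this is the Cartan
matrix. -/
noncomputable def dimMatrix (M : Bimodule K A B) (S : SplitIdempotents K A ι)
    (S' : SplitIdempotents K B ι') : Matrix ι ι' ℤ :=
  .of fun i j => Module.finrank K (corner K M.carrier (S.e i) (S'.e j))

theorem exists_dimMatrix_eq_cartan_mul (M : Bimodule K A B) (S : SplitIdempotents K A ι)
    (S' : SplitIdempotents K B ι') [FiniteDimensional K A] [FiniteDimensional K M.carrier]
    [Module.Projective A M.carrier] :
    ∃ m : Matrix ι ι' ℤ, M.dimMatrix S S' = S.cartan * m := by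
  have := Module.Finite.of_restrictScalars_finite K A M.carrier
  choose r D using fun j => S.nonempty_idempotentBasis
    (ε := Algebra.lsmul K A M.carrier (S'.op.e j)) ((S'.op.complete.idem j).map _)
  refine ⟨.of fun k j => ((D j).some.mult k : ℤ), ?_⟩
  ext i j
  simp only [dimMatrix, corner, SplitIdempotents.cartan, Matrix.mul_apply, Matrix.of_apply]
  exact_mod_cast ((D j).some.finrank_range (K := K) S.mul_e_self (S.mul_e_self i)).trans
    (Finset.sum_congr rfl fun k _ => mul_comm _ _)

theorem exists_dimMatrix_eq_mul_cartan (M : Bimodule K A B) (S : SplitIdempotents K A ι)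
    (S' : SplitIdempotents K B ι') [FiniteDimensional K B] [FiniteDimensional K M.carrier]
    [Module.Projective Bᵐᵒᵖ M.carrier] :
    ∃ m : Matrix ι ι' ℤ, M.dimMatrix S S' = m * S'.cartan ∧
      ∀ N : Bimodule K B A, FiniteDimensional K N.carrier →
        (M.tensor N).dimMatrix S S = m * N.dimMatrix S' S := by
  have := Module.Finite.of_restrictScalars_finite K Bᵐᵒᵖ M.carrier
  choose r D using fun i => S'.op.nonempty_idempotentBasis
    (ε := Algebra.lsmul K Bᵐᵒᵖ M.carrier (S.e i)) ((S.complete.idem i).map _)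
  refine ⟨.of fun i k => ((D i).some.mult k : ℤ), ?_, fun N _ => ?_⟩
  · ext i j
    have corner_eq : corner K M.carrier (S.e i) (S'.e j) =
        LinearMap.range (Algebra.lsmul K K M.carrier (S'.op.e j) ∘ₗ
          (Algebra.lsmul K Bᵐᵒᵖ M.carrier (S.e i)).restrictScalars K) :=
      congrArg LinearMap.range (LinearMap.ext fun x => smul_comm (S.e i) (S'.op.e j) x)
    simp only [dimMatrix, SplitIdempotents.cartan, Matrix.mul_apply, Matrix.of_apply]
    rw [corner_eq, (D i).some.finrank_range (K := K) S'.op.mul_e_self (S'.op.mul_e_self j)]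
    push_cast
    refine Finset.sum_congr rfl fun k _ => ?_
    rw [S'.op_e, S'.op_e, finrank_peirce_op]
  · ext i j
    simp only [dimMatrix, Matrix.mul_apply, Matrix.of_apply]
    exact_mod_cast finrank_corner_tensor N S' (D i).some (S.mul_e_self j)

attribute [local instance] TensorProduct.Algebra.module in
theorem isScalarTower_tensorProduct (P : Bimodule K A A) :
    IsScalarTower K (A ⊗[K] Aᵐᵒᵖ) P.carrier :=
  ⟨fun c t x => by
    change TensorProduct.Algebra.moduleAux (c • t) x = c • TensorProduct.Algebra.moduleAux t x
    simp⟩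

attribute [local instance] TensorProduct.Algebra.module in
theorem exists_dimMatrix_eq_cartan_mul_mul_cartan (P : Bimodule K A A)
    (S : SplitIdempotents K A ι) [FiniteDimensional K A] [FiniteDimensional K P.carrier]
    (hP : IsProjectiveBimodule P) :
    ∃ p : Matrix ι ι ℤ, P.dimMatrix S S = S.cartan * p * S.cartan := by
  have : Module.Projective (A ⊗[K] Aᵐᵒᵖ) P.carrier := hP
  have := P.isScalarTower_tensorProduct
  have := Module.Finite.of_restrictScalars_finite K (A ⊗[K] Aᵐᵒᵖ) P.carrier
  obtain ⟨r, ⟨D⟩⟩ := (S.tensor S.op).nonempty_idempotentBasis (V := P.carrier)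
    (ε := 1) .one
  refine ⟨.of fun k l => (D.mult (k, l) : ℤ), ?_⟩
  ext i j
  have h := D.finrank_range (K := K) (S.tensor S.op).mul_e_self ((S.tensor S.op).mul_e_self (i, j))
  have range_eq : LinearMap.range (Algebra.lsmul K K P.carrier ((S.tensor S.op).e (i, j)) ∘ₗ
      (1 : Module.End (A ⊗[K] Aᵐᵒᵖ) P.carrier).restrictScalars K) =
      corner K P.carrier (S.e i) (S.e j) :=
    rfl
  rw [range_eq] at h
  simp only [dimMatrix, SplitIdempotents.cartan, Matrix.mul_apply, Matrix.of_apply, h,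
    Fintype.sum_prod_type, Finset.sum_mul]
  push_cast
  rw [Finset.sum_comm]
  refine Finset.sum_congr rfl fun k _ => Finset.sum_congr rfl fun l _ => ?_
  rw [S.tensor_e, S.tensor_e, S.op_e, S.op_e, finrank_peirce_tmul, finrank_peirce_op]
  push_cast
  ring

end Bimodule

theorem finrank_corner_prod [FiniteDimensional K A] {P : Bimodule K A A}
    [FiniteDimensional K P.carrier] (e f : A) :
    Module.finrank K (corner K (A × P.carrier) e f) =
      Module.finrank K (peirce K e f) + Module.finrank K (corner K P.carrier e f) := by
  have h : corner K (A × P.carrier) e f = (peirce K e f).prod (corner K P.carrier e f) := by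
    rw [peirce, corner, corner, ← LinearMap.range_prodMap]
    rfl
  rw [h, ← Module.finrank_prod, ← LinearMap.finrank_range_of_inj (f :=
    (peirce K e f).subtype.prodMap (corner K P.carrier e f).subtype)
    (Function.Injective.prodMap (Submodule.subtype_injective _) (Submodule.subtype_injective _)),
    LinearMap.range_prodMap, Submodule.range_subtype, Submodule.range_subtype]

theorem TensorIsoRegularSum.finiteDimensional {M : Bimodule K A B} {N : Bimodule K B A}
    {P : Bimodule K A A} (h : TensorIsoRegularSum M N P) [FiniteDimensional K M.carrier]
    [FiniteDimensional K N.carrier] : FiniteDimensional K P.carrier := by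
  obtain ⟨Φ, -⟩ := h
  exact Module.Finite.of_surjective (LinearMap.snd K A P.carrier ∘ₗ Φ.toLinearMap)
    (Prod.snd_surjective.comp Φ.surjective)

theorem TensorIsoRegularSum.dimMatrix_tensor {M : Bimodule K A B} {N : Bimodule K B A}
    {P : Bimodule K A A} (h : TensorIsoRegularSum M N P) (S : SplitIdempotents K A ι)
    [FiniteDimensional K A] [FiniteDimensional K P.carrier] :
    (M.tensor N).dimMatrix S S = S.cartan + P.dimMatrix S S := by
  obtain ⟨E, hE⟩ := h.exists_equiv
  ext i j
  have corner_eq : corner K (A × P.carrier) (S.e i) (S.e j) =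
      (corner K (M.tensor N).carrier (S.e i) (S.e j)).map
        (E.restrictScalars K).toLinearMap := by
    rw [corner, corner, ← LinearMap.range_comp,
      ← LinearMap.range_comp_of_range_eq_top _ (E.restrictScalars K).range]
    exact congrArg LinearMap.range (LinearMap.ext fun x => by simp [hE])
  have := finrank_corner_prod (P := P) (S.e i) (S.e j)
  rw [corner_eq, LinearEquiv.finrank_map_eq] at this
  simp only [Bimodule.dimMatrix, SplitIdempotents.cartan, Matrix.add_apply, Matrix.of_apply]
  exact_mod_cast this

theorem StablyEquivalentOfMoritaType.det_cartan_dvd (h : StablyEquivalentOfMoritaType K A B)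
    [FiniteDimensional K A] [FiniteDimensional K B] (S : SplitIdempotents K A ι)
    (S' : SplitIdempotents K B ι') (hdet : S.cartan.det ≠ 0) :
    S.cartan.det ∣ S'.cartan.det := by
  obtain ⟨M, N, P, Q, _, _, _, _, _, _, hP, -, hMN, -⟩ := h
  have := hMN.finiteDimensional
  obtain ⟨m, hm, hm'⟩ := M.exists_dimMatrix_eq_mul_cartan S S'
  obtain ⟨m', hM⟩ := M.exists_dimMatrix_eq_cartan_mul S S'
  obtain ⟨n, hn, -⟩ := N.exists_dimMatrix_eq_mul_cartan S' S
  obtain ⟨p, hp⟩ := P.exists_dimMatrix_eq_cartan_mul_mul_cartan S hP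
  have m_n_cartan : m * n * S.cartan = (1 + S.cartan * p) * S.cartan := by
    rw [Matrix.mul_assoc, ← hn, ← hm' N inferInstance, hMN.dimMatrix_tensor, hp, add_mul, one_mul]
  refine det_dvd_det (n := n) (p := p) (hm.symm.trans hM) (smul_right_injective _ hdet ?_)
  simpa only [Matrix.mul_assoc, Matrix.mul_adjugate, Matrix.mul_smul, Matrix.mul_one] using
    congrArg (· * S.cartan.adjugate) m_n_cartan

end DimMatrix

/-! ### The transfer of a bimodule -/

section Transfer

variable {K : Type u} [Field K] {A : Type v} [Ring A] [Algebra K A] {B : Type w} [Ring B]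
  [Algebra K B] {M : Bimodule K A B} {N : Bimodule K B A} {ι κ : Type*} [Fintype ι] [Fintype κ]

namespace DualBasis

/-- The transfer `B → A` of an `A`-`B`-bimodule: the Hattori–Stallings trace of the right
multiplication by an element of `B`. -/
def transfer (D : DualBasis A M.carrier ι) : B →ₗ[K] A where
  toFun b := D.tr (Algebra.lsmul K A M.carrier (MulOpposite.op b))
  map_add' := by simp [tr, Finset.sum_add_distrib]
  map_smul' c b := by
    simp only [tr, Algebra.lsmul_coe, MulOpposite.op_smul, smul_assoc, Finset.smul_sum,
      RingHom.id_apply]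
    exact Finset.sum_congr rfl fun i _ => map_smul ((D.coord i).restrictScalars K) c _

theorem isTraceForm_comp_transfer (D : DualBasis A M.carrier ι) {σ : A →ₗ[K] K}
    (hσ : IsTraceForm σ) : IsTraceForm (σ ∘ₗ D.transfer) := fun b b' => by
  have := D.tr_comm D hσ (Algebra.lsmul K A M.carrier (MulOpposite.op b))
    (Algebra.lsmul K A M.carrier (MulOpposite.op b'))
  simp only [← Module.End.mul_eq_comp, ← map_mul, ← MulOpposite.op_mul] at this
  exact this

theorem transfer_mem_jacobson [FiniteDimensional K B] [DecidableEq κ]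
    (D : DualBasis A M.carrier ι) (S : SplitIdempotents K A κ) {b : B}
    (hb : b ∈ Ring.jacobson B) : D.transfer b ∈ Ring.jacobson A :=
  S.mem_jacobson fun i => D.map_tr_eq_zero (S.π i : A →+* K) (by
    obtain ⟨n, hn⟩ := isNilpotent_of_mem_jacobson K hb
    exact ⟨n, by rw [← map_pow, ← MulOpposite.op_pow, hn, MulOpposite.op_zero, map_zero]⟩)

end DualBasis

namespace Bimodule

section TensorLiftLeft

variable {W : Type*} [AddCommGroup W] [Module K W] [Module A W] [IsScalarTower K A W]

/-- The homomorphism of left modules out of `M ⊗[B] N` given by a balanced bilinear map. -/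
def tensorLiftLeft (f : M.carrier →ₗ[K] N.carrier →ₗ[K] W)
    (hf : ∀ m (b : B) n, f (MulOpposite.op b • m) n = f m (b • n))
    (hA : ∀ (a : A) m n, f (a • m) n = a • f m n) : (M.tensor N).carrier →ₗ[A] W :=
  { tensorLift f hf with
    map_smul' := fun a => LinearMap.congr_fun (f := tensorLift f hf ∘ₗ Algebra.lsmul K K _ a)
      (g := Algebra.lsmul K K W a ∘ₗ tensorLift f hf) (tensor_ext fun m n => by simp [hA]) }

@[simp]
theorem tensorLiftLeft_tmul (f : M.carrier →ₗ[K] N.carrier →ₗ[K] W)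
    (hf : ∀ m (b : B) n, f (MulOpposite.op b • m) n = f m (b • n))
    (hA : ∀ (a : A) m n, f (a • m) n = a • f m n) (m : M.carrier) (n : N.carrier) :
    tensorLiftLeft f hf hA (tmul M N m n) = f m n :=
  tensorLift_tmul f hf m n

end TensorLiftLeft

variable (M) in
/-- The map `m ⊗ n ↦ m f(n)` on `M ⊗[B] N` induced by a homomorphism `f : N → B` of left
modules. -/
def contractRight (f : N.carrier →ₗ[B] B) : (M.tensor N).carrier →ₗ[A] M.carrier :=
  tensorLiftLeft
    (LinearMap.mk₂ K (fun m n => MulOpposite.op (f n) • m) (by simp)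
      (fun c m n => smul_comm _ _ _) (by simp [add_smul])
      (fun c m n => by
        rw [← LinearMap.coe_restrictScalars K f, map_smul, MulOpposite.op_smul, smul_assoc]))
    (fun m b n => by simp [smul_smul]) (fun a m n => smul_comm _ _ _)

@[simp]
theorem contractRight_tmul (f : N.carrier →ₗ[B] B) (m : M.carrier) (n : N.carrier) :
    contractRight M f (tmul M N m n) = MulOpposite.op (f n) • m :=
  tensorLiftLeft_tmul _ _ _ m n

variable (M N) in
/-- The action `m ⊗ n ↦ m z ⊗ n = m ⊗ z n` of the centre of `B` on `M ⊗[B] N`. -/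
def centralAction (z : Subalgebra.center K B) : Module.End A (M.tensor N).carrier :=
  tensorLiftLeft (tmul M N ∘ₗ Algebra.lsmul K K M.carrier (MulOpposite.op (z : B)))
    (fun m b n => by
      simp only [LinearMap.comp_apply, Algebra.lsmul_coe, ← op_smul_tmul, smul_smul,
        ← MulOpposite.op_mul, Subalgebra.mem_center_iff.mp z.2 b])
    (fun a m n => by simp [smul_comm a])

@[simp]
theorem centralAction_tmul (z : Subalgebra.center K B) (m : M.carrier) (n : N.carrier) :
    centralAction M N z (tmul M N m n) = tmul M N (MulOpposite.op (z : B) • m) n :=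
  tensorLiftLeft_tmul _ _ _ m n

theorem centralAction_op_smul (z : Subalgebra.center K B) (a : A) (x : (M.tensor N).carrier) :
    centralAction M N z (MulOpposite.op a • x) = MulOpposite.op a • centralAction M N z x :=
  LinearMap.congr_fun
    (f := (centralAction M N z).restrictScalars K ∘ₗ Algebra.lsmul K K _ (MulOpposite.op a))
    (g := Algebra.lsmul K K _ (MulOpposite.op a) ∘ₗ (centralAction M N z).restrictScalars K)
    (tensor_ext fun m n => by simp) x

@[simp]
theorem centralAction_one : centralAction M N 1 = 1 :=
  LinearMap.restrictScalars_injective K (tensor_ext fun m n => by simp)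

end Bimodule

namespace DualBasis

open Bimodule

/-- The dual basis of the left module `M ⊗[B] N` given by those of `M` and `N`. -/
def tensor (D : DualBasis A M.carrier ι) (E : DualBasis B N.carrier κ) :
    DualBasis A (M.tensor N).carrier (ι × κ) where
  vec p := tmul M N (D.vec p.1) (E.vec p.2)
  coord p := D.coord p.1 ∘ₗ contractRight M (E.coord p.2)
  sum_coord_smul v := by
    have : ∑ p : ι × κ, ((D.coord p.1 ∘ₗ contractRight M (E.coord p.2)).smulRight
        (tmul M N (D.vec p.1) (E.vec p.2))).restrictScalars K = LinearMap.id :=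
      tensor_ext fun m n => by
        simp only [LinearMap.sum_apply, LinearMap.restrictScalars_apply, LinearMap.smulRight_apply,
          LinearMap.comp_apply, contractRight_tmul, smul_tmul, LinearMap.id_apply,
          Fintype.sum_prod_type_right]
        simp only [← LinearMap.sum_apply, ← map_sum, D.sum_coord_smul, op_smul_tmul,
          E.sum_coord_smul]
    simpa using LinearMap.congr_fun this v

theorem tr_tensor (D : DualBasis A M.carrier ι) (E : DualBasis B N.carrier κ)
    {h : Module.End A (M.tensor N).carrier} {a : A} {z : B}
    (hh : ∀ m n, h (tmul M N m n) = tmul M N (MulOpposite.op z • m) (MulOpposite.op a • n)) :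
    (D.tensor E).tr h = D.transfer (z * E.transfer a) := by
  simp only [tr, tensor, transfer, hh, LinearMap.comp_apply, contractRight_tmul, LinearMap.coe_mk,
    AddHom.coe_mk, Algebra.lsmul_coe, Finset.mul_sum, MulOpposite.op_mul, map_sum,
    Fintype.sum_prod_type_right, mul_smul]

end DualBasis

end Transfer

section ProjectiveBimodule

variable {K : Type u} [Field K] {A : Type v} [Ring A] [Algebra K A] {ι κ : Type*} [Fintype ι]
  [Fintype κ]

attribute [local instance] TensorProduct.Algebra.module

theorem Bimodule.isScalarTower_left_tensorProduct (P : Bimodule K A A) :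
    IsScalarTower A (A ⊗[K] Aᵐᵒᵖ) P.carrier :=
  ⟨fun a t x => by
    induction t with
    | zero =>
      have zero_smul_x : (0 : A ⊗[K] Aᵐᵒᵖ) • x = 0 := zero_smul (A ⊗[K] Aᵐᵒᵖ) x
      simp only [smul_zero, zero_smul_x]
    | tmul b c => simp only [TensorProduct.smul_tmul', TensorProduct.Algebra.smul_def, smul_assoc]
    | add s t hs ht => simp only [smul_add, add_smul, hs, ht]⟩

/-- The map `a ⊗ c ↦ ξ c • a`. -/
noncomputable def evalRight (A : Type v) [Ring A] [Algebra K A] (ξ : Aᵐᵒᵖ →ₗ[K] K) :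
    A ⊗[K] Aᵐᵒᵖ →ₗ[A] A :=
  (TensorProduct.AlgebraTensorModule.rid K A A).toLinearMap ∘ₗ
    TensorProduct.AlgebraTensorModule.map LinearMap.id ξ

@[simp]
theorem evalRight_tmul (ξ : Aᵐᵒᵖ →ₗ[K] K) (a : A) (c : Aᵐᵒᵖ) :
    evalRight A ξ (a ⊗ₜ c) = ξ c • a := by
  simp [evalRight]

/-- A dual basis of the bimodule `P` gives one of the left module `P`, as `A ⊗ Aᵐᵒᵖ` is free over
`A`. -/
noncomputable def DualBasis.restrictLeft {P : Bimodule K A A}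
    (D : DualBasis (A ⊗[K] Aᵐᵒᵖ) P.carrier ι) (x : Module.Basis κ K Aᵐᵒᵖ) :
    DualBasis A P.carrier (ι × κ) where
  vec p := x p.2 • D.vec p.1
  coord p :=
    haveI := P.isScalarTower_left_tensorProduct
    evalRight A (x.coord p.2) ∘ₗ (D.coord p.1).restrictScalars A
  sum_coord_smul v := by
    have expand : ∀ (t : A ⊗[K] Aᵐᵒᵖ) (y : P.carrier),
        ∑ k, evalRight A (x.coord k) t • x k • y = t • y := fun t y => by
      induction t with
      | zero =>
        simp only [map_zero, zero_smul, Finset.sum_const_zero]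
        exact (zero_smul (A ⊗[K] Aᵐᵒᵖ) y).symm
      | tmul a c =>
        calc ∑ k, evalRight A (x.coord k) (a ⊗ₜ c) • x k • y = a • (∑ k, x.repr c k • x k) • y := by
              simp only [evalRight_tmul, Module.Basis.coord_apply, smul_assoc, Finset.sum_smul,
                Finset.smul_sum, smul_comm a]
          _ = (a ⊗ₜ[K] c) • y := by rw [x.sum_repr, TensorProduct.Algebra.smul_def]
      | add s t hs ht => simp only [map_add, add_smul, Finset.sum_add_distrib, hs, ht]
    simp only [LinearMap.comp_apply, LinearMap.restrictScalars_apply, Fintype.sum_prod_type, expand,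
      D.sum_coord_smul]

theorem sum_coord_mul_mul_eq_zero {R : Type*} [Ring R] [Algebra K R] (x : Module.Basis κ K R)
    {b : R} (hb : IsNilpotent b) (c : R) : ∑ k, x.coord k (b * x k * c) = 0 := by
  classical
  have nil : IsNilpotent (LinearMap.mulLeft K b * LinearMap.mulRight K c) :=
    (LinearMap.commute_mulLeft_right b c).isNilpotent_mul_right
      ((LinearMap.isNilpotent_mulLeft_iff K b).mpr hb)
  have := (LinearMap.isNilpotent_trace_of_isNilpotent nil).eq_zero
  rw [LinearMap.trace_eq_matrix_trace K x, Matrix.trace] at this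
  simpa [LinearMap.toMatrix_apply, mul_assoc] using this

theorem DualBasis.tr_restrictLeft_eq_zero {P : Bimodule K A A}
    (D : DualBasis (A ⊗[K] Aᵐᵒᵖ) P.carrier ι) (x : Module.Basis κ K Aᵐᵒᵖ)
    {ψ : Module.End A P.carrier}
    (hψ : ∀ (a : A) v, ψ (MulOpposite.op a • v) = MulOpposite.op a • ψ v) {a : A}
    (ha : IsNilpotent a) :
    (D.restrictLeft x).tr (ψ ∘ₗ Algebra.lsmul K A P.carrier (MulOpposite.op a)) = 0 := by
  have ha' : IsNilpotent (MulOpposite.op a) := by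
    obtain ⟨n, hn⟩ := ha
    exact ⟨n, by rw [← MulOpposite.op_pow, hn, MulOpposite.op_zero]⟩
  have trace : ∀ t : A ⊗[K] Aᵐᵒᵖ,
      ∑ k, evalRight A (x.coord k) ((1 ⊗ₜ (MulOpposite.op a * x k)) * t) = 0 := fun t => by
    induction t with
    | zero => simp
    | tmul b c =>
      simp only [Algebra.TensorProduct.tmul_mul_tmul, one_mul, evalRight_tmul, ← Finset.sum_smul,
        sum_coord_mul_mul_eq_zero x ha', zero_smul]
    | add s t hs ht => simp only [mul_add, map_add, Finset.sum_add_distrib, hs, ht, add_zero]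
  have one_tmul_smul : ∀ (c : Aᵐᵒᵖ) (v : P.carrier), c • v = ((1 : A) ⊗ₜ[K] c) • v :=
    fun c v => by rw [TensorProduct.Algebra.smul_def, one_smul]
  rw [tr, Fintype.sum_prod_type]
  refine Finset.sum_eq_zero fun i _ => (Finset.sum_congr rfl fun k _ => ?_).trans
    (trace (D.coord i (ψ (D.vec i))))
  have hψ' : ∀ (c : Aᵐᵒᵖ) v, ψ (c • v) = c • ψ v := fun c => hψ c.unop
  simp only [restrictLeft, LinearMap.comp_apply, LinearMap.restrictScalars_apply,
    Algebra.lsmul_coe, smul_smul, hψ']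
  rw [one_tmul_smul, map_smul, smul_eq_mul]

end ProjectiveBimodule

section StableTransfer

namespace DualBasis

variable {K : Type*} [Field K] {R : Type*} [Ring R] [Algebra K R] {V W ι κ : Type*}
  [AddCommGroup V] [Module R V] [AddCommGroup W] [Module R W] [Fintype ι] [Fintype κ]

/-- The dual basis of the regular module. -/
def regular (R : Type*) [Ring R] : DualBasis R R Unit where
  vec _ := 1
  coord _ := LinearMap.id
  sum_coord_smul := by simp

theorem tr_eq_add_tr (D : DualBasis R V ι) (D' : DualBasis R W κ) {τ : R →ₗ[K] K}
    (hτ : IsTraceForm τ) (E : V ≃ₗ[R] R × W) (h : Module.End R V) :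
    τ (D.tr h) = τ (E (h (E.symm (1, 0)))).1 +
      τ (D'.tr (LinearMap.snd R R W ∘ₗ E.toLinearMap ∘ₗ h ∘ₗ E.symm.toLinearMap ∘ₗ
        LinearMap.inr R R W)) := by
  have split : D.tr h =
      D.tr ((h ∘ₗ E.symm.toLinearMap ∘ₗ LinearMap.inl R R W) ∘ₗ
        LinearMap.fst R R W ∘ₗ E.toLinearMap) +
      D.tr ((h ∘ₗ E.symm.toLinearMap ∘ₗ LinearMap.inr R R W) ∘ₗ
        LinearMap.snd R R W ∘ₗ E.toLinearMap) := by
    simp only [tr, ← Finset.sum_add_distrib, ← map_add, LinearMap.comp_apply,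
      LinearMap.inl_apply, LinearMap.inr_apply, LinearMap.fst_apply, LinearMap.snd_apply,
      Prod.mk_add_mk, add_zero, zero_add, LinearEquiv.coe_coe, Prod.mk.eta, E.symm_apply_apply]
  rw [split, map_add, D.tr_comm (regular R) hτ, D.tr_comm D' hτ]
  simp [regular, tr]

end DualBasis

section Bimodules

variable {K : Type u} [Field K] {A : Type v} [Ring A] [Algebra K A] {ι κ : Type*} [Fintype ι]
  [Fintype κ]

attribute [local instance] TensorProduct.Algebra.module in
/-- Endomorphisms of a projective bimodule composed with the action of a nilpotent element have
trace zero, so only the regular summand contributes to the trace on the left. -/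
theorem DualBasis.map_tr_comp_op_smul {X P : Bimodule K A A} [FiniteDimensional K A]
    (D : DualBasis A X.carrier ι) (F : DualBasis (A ⊗[K] Aᵐᵒᵖ) P.carrier κ)
    (E : X.carrier ≃ₗ[A] A × P.carrier)
    (hE : ∀ (a : A) x, E (MulOpposite.op a • x) = MulOpposite.op a • E x)
    {ξ : Module.End A X.carrier}
    (hξ : ∀ (a : A) x, ξ (MulOpposite.op a • x) = MulOpposite.op a • ξ x)
    {τ : A →ₗ[K] K} (hτ : IsTraceForm τ) {a : A} (ha : IsNilpotent a) :
    τ (D.tr (ξ ∘ₗ Algebra.lsmul K A X.carrier (MulOpposite.op a))) =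
      τ ((E (ξ (E.symm (1, 0)))).1 * a) := by
  have hE' : ∀ (a : A) y, E.symm (MulOpposite.op a • y) = MulOpposite.op a • E.symm y :=
    fun a y => by rw [E.symm_apply_eq, hE, E.apply_symm_apply]
  have op_smul_inr : ∀ (b : A) (y : P.carrier), ((0 : A), MulOpposite.op b • y) =
      MulOpposite.op b • (0, y) := fun b y => by rw [Prod.smul_mk, smul_zero]
  let ψ : Module.End A P.carrier := LinearMap.snd A A P.carrier ∘ₗ E.toLinearMap ∘ₗ ξ ∘ₗ
    E.symm.toLinearMap ∘ₗ LinearMap.inr A A P.carrier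
  have ψ_op_smul : ∀ (b : A) y, ψ (MulOpposite.op b • y) = MulOpposite.op b • ψ y := fun b y => by
    change (E (ξ (E.symm (0, MulOpposite.op b • y)))).2 = _
    rw [op_smul_inr, hE', hξ, hE]
    rfl
  have corner : LinearMap.snd A A P.carrier ∘ₗ E.toLinearMap ∘ₗ
      (ξ ∘ₗ Algebra.lsmul K A X.carrier (MulOpposite.op a)) ∘ₗ E.symm.toLinearMap ∘ₗ
        LinearMap.inr A A P.carrier =
      ψ ∘ₗ Algebra.lsmul K A P.carrier (MulOpposite.op a) := LinearMap.ext fun y => by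
    change _ = (E (ξ (E.symm (0, MulOpposite.op a • y)))).2
    rw [op_smul_inr, hE']
    rfl
  rw [D.tr_eq_add_tr (F.restrictLeft (Module.finBasis K Aᵐᵒᵖ)) hτ E, corner,
    F.tr_restrictLeft_eq_zero _ ψ_op_smul ha, map_zero, add_zero]
  change τ (E (ξ (MulOpposite.op a • E.symm (1, 0)))).1 = _
  rw [hξ, hE]
  rfl

variable {B : Type w} [Ring B] [Algebra K B] {M : Bimodule K A B} {N : Bimodule K B A}
  {P : Bimodule K A A}

attribute [local instance] TensorProduct.Algebra.module in
theorem TensorIsoRegularSum.exists_center_transfer (h : TensorIsoRegularSum M N P)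
    (hP : IsProjectiveBimodule P) [FiniteDimensional K A] [FiniteDimensional K P.carrier]
    (D : DualBasis A M.carrier ι) (D' : DualBasis B N.carrier κ) (z : Subalgebra.center K B) :
    ∃ w : Subalgebra.center K A, (z = 1 → w = 1) ∧ ∀ τ : A →ₗ[K] K, IsTraceForm τ →
      ∀ a ∈ Ring.jacobson A, τ (D.transfer (z * D'.transfer a)) = τ (w * a) := by
  have : Module.Projective (A ⊗[K] Aᵐᵒᵖ) P.carrier := hP
  have := P.isScalarTower_tensorProduct
  have := Module.Finite.of_restrictScalars_finite K (A ⊗[K] Aᵐᵒᵖ) P.carrier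
  obtain ⟨_, ⟨F⟩⟩ := DualBasis.nonempty (A ⊗[K] Aᵐᵒᵖ) P.carrier
  obtain ⟨E, hE⟩ := h.exists_equiv
  have hE' : ∀ (a : A) y, E.symm (MulOpposite.op a • y) = MulOpposite.op a • E.symm y :=
    fun a y => by rw [E.symm_apply_eq, hE, E.apply_symm_apply]
  let ξ := Bimodule.centralAction M N z
  set w := (E (ξ (E.symm (1, 0)))).1 with hw
  have w_mem : w ∈ Subalgebra.center K A := Subalgebra.mem_center_iff.mpr fun a => by
    have w_mul : (E (ξ (MulOpposite.op a • E.symm (1, 0)))).1 = w * a := by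
      rw [Bimodule.centralAction_op_smul, hE]
      rfl
    rw [← w_mul, ← hE', hw, ← smul_eq_mul, ← Prod.smul_fst, ← map_smul, ← map_smul, ← map_smul]
    simp
  refine ⟨⟨w, w_mem⟩, fun hz => Subtype.ext (by simp [hw, ξ, hz]), fun τ hτ a ha => ?_⟩
  rw [← D.tr_tensor D' (h := ξ ∘ₗ Algebra.lsmul K A (M.tensor N).carrier (MulOpposite.op a))
    fun m n => by simp [ξ]]
  exact (D.tensor D').map_tr_comp_op_smul F E hE (Bimodule.centralAction_op_smul z) hτ
    (isNilpotent_of_mem_jacobson K ha)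

end Bimodules

end StableTransfer

/-! ### Isomorphism of the stable centres -/

section StableCentre

theorem nonempty_quotient_algEquiv_of_graph {K R S : Type*} [CommRing K] [CommRing R] [Algebra K R]
    [CommRing S] [Algebra K S] {Γ : Subalgebra K (R × S)} (fst : ∀ r, ∃ s, (r, s) ∈ Γ)
    (snd : ∀ s, ∃ r, (r, s) ∈ Γ) {I : Ideal R} {J : Ideal S}
    (h : ∀ r s, (r, s) ∈ Γ → (r ∈ I ↔ s ∈ J)) : Nonempty ((R ⧸ I) ≃ₐ[K] (S ⧸ J)) := by
  let f : Γ →ₐ[K] R ⧸ I := ((Ideal.Quotient.mkₐ K I).comp (AlgHom.fst K R S)).comp Γ.val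
  let g : Γ →ₐ[K] S ⧸ J := ((Ideal.Quotient.mkₐ K J).comp (AlgHom.snd K R S)).comp Γ.val
  have hf : Function.Surjective f := fun x => by
    obtain ⟨r, rfl⟩ := Ideal.Quotient.mk_surjective x
    obtain ⟨s, hs⟩ := fst r
    exact ⟨⟨_, hs⟩, rfl⟩
  have hg : Function.Surjective g := fun x => by
    obtain ⟨s, rfl⟩ := Ideal.Quotient.mk_surjective x
    obtain ⟨r, hr⟩ := snd s
    exact ⟨⟨_, hr⟩, rfl⟩
  have ker_eq : RingHom.ker f = RingHom.ker g := by
    ext ⟨⟨r, s⟩, hp⟩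
    exact Ideal.Quotient.eq_zero_iff_mem.trans
      ((h r s hp).trans Ideal.Quotient.eq_zero_iff_mem.symm)
  exact ⟨(Ideal.quotientKerAlgEquivOfSurjective hf).symm.trans
    ((Ideal.quotientEquivAlgOfEq K ker_eq).trans (Ideal.quotientKerAlgEquivOfSurjective hg))⟩

variable {K : Type*} [Field K] {A : Type*} [Ring A] [Algebra K A] {B : Type*} [Ring B] [Algebra K B]

theorem IsTraceForm.comp_mulLeft {τ : A →ₗ[K] K} (hτ : IsTraceForm τ) (z : Subalgebra.center K A) :
    IsTraceForm (τ ∘ₗ LinearMap.mulLeft K (z : A)) := fun a b => by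
  have hz := Subalgebra.mem_center_iff.mp z.2
  simp only [LinearMap.comp_apply, LinearMap.mulLeft_apply]
  rw [← mul_assoc, ← hz, mul_assoc, hτ, mul_assoc]

variable (K A B) in
/-- What the transfers of the bimodules of a stable equivalence of Morita type have in common: as
far as trace forms can see, they are inverse to each other on the radicals. -/
structure StableTransfer where
  /-- The transfer along the first bimodule. -/
  map : B →ₗ[K] A
  /-- The transfer along the second bimodule. -/
  inv : A →ₗ[K] B
  isTraceForm_comp_map : ∀ {σ : A →ₗ[K] K}, IsTraceForm σ → IsTraceForm (σ ∘ₗ map)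
  isTraceForm_comp_inv : ∀ {τ : B →ₗ[K] K}, IsTraceForm τ → IsTraceForm (τ ∘ₗ inv)
  map_mem_jacobson : ∀ {b}, b ∈ Ring.jacobson B → map b ∈ Ring.jacobson A
  inv_mem_jacobson : ∀ {a}, a ∈ Ring.jacobson A → inv a ∈ Ring.jacobson B
  exists_map_mul_inv : ∀ w : Subalgebra.center K B, ∃ z : Subalgebra.center K A, (w = 1 → z = 1) ∧
    ∀ σ : A →ₗ[K] K, IsTraceForm σ → ∀ a ∈ Ring.jacobson A, σ (map (w * inv a)) = σ (z * a)
  exists_inv_mul_map : ∀ z : Subalgebra.center K A, ∃ w : Subalgebra.center K B, (z = 1 → w = 1) ∧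
    ∀ τ : B →ₗ[K] K, IsTraceForm τ → ∀ b ∈ Ring.jacobson B, τ (inv (z * map b)) = τ (w * b)

theorem StablyEquivalentOfMoritaType.nonempty_stableTransfer {K : Type u} [Field K] {A : Type v}
    [Ring A] [Algebra K A] {B : Type w} [Ring B] [Algebra K B] {ι κ : Type*} [Fintype ι]
    [DecidableEq ι] [Fintype κ] [DecidableEq κ] (h : StablyEquivalentOfMoritaType K A B)
    [FiniteDimensional K A] [FiniteDimensional K B] (S : SplitIdempotents K A ι)
    (S' : SplitIdempotents K B κ) : Nonempty (StableTransfer K A B) := by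
  obtain ⟨M, N, P, Q, _, _, _, -, _, -, hP, hQ, hMN, hNM⟩ := h
  have := hMN.finiteDimensional
  have := hNM.finiteDimensional
  have := Module.Finite.of_restrictScalars_finite K A M.carrier
  have := Module.Finite.of_restrictScalars_finite K B N.carrier
  obtain ⟨_, ⟨D⟩⟩ := DualBasis.nonempty A M.carrier
  obtain ⟨_, ⟨D'⟩⟩ := DualBasis.nonempty B N.carrier
  exact ⟨{
    map := D.transfer
    inv := D'.transfer
    isTraceForm_comp_map := D.isTraceForm_comp_transfer
    isTraceForm_comp_inv := D'.isTraceForm_comp_transfer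
    map_mem_jacobson := D.transfer_mem_jacobson S
    inv_mem_jacobson := D'.transfer_mem_jacobson S'
    exists_map_mul_inv := hMN.exists_center_transfer hP D D'
    exists_inv_mul_map := hNM.exists_center_transfer hQ D' D }⟩

namespace StableTransfer

/-- The transfers in the other order. -/
def symm (T : StableTransfer K A B) : StableTransfer K B A where
  map := T.inv
  inv := T.map
  isTraceForm_comp_map := T.isTraceForm_comp_inv
  isTraceForm_comp_inv := T.isTraceForm_comp_map
  map_mem_jacobson := T.inv_mem_jacobson
  inv_mem_jacobson := T.map_mem_jacobson
  exists_map_mul_inv := T.exists_inv_mul_map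
  exists_inv_mul_map := T.exists_map_mul_inv

theorem apply_map_inv (T : StableTransfer K A B) {σ : A →ₗ[K] K} (hσ : IsTraceForm σ) {a : A}
    (ha : a ∈ Ring.jacobson A) : σ (T.map (T.inv a)) = σ a := by
  obtain ⟨z, hz, h⟩ := T.exists_map_mul_inv 1
  simpa [hz rfl] using h σ hσ a ha

/-- The pairs of central elements that correspond to each other under the transfer. -/
def centerGraph (T : StableTransfer K A B) :
    Subalgebra K (Subalgebra.center K A × Subalgebra.center K B) where
  carrier := {p | ∀ σ : A →ₗ[K] K, IsTraceForm σ → ∀ b ∈ Ring.jacobson B,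
    σ (T.map (p.2 * b)) = σ (p.1 * T.map b)}
  mul_mem' := fun {p q} hp hq σ hσ b hb => by
    have := hq _ (hσ.comp_mulLeft p.1) b hb
    simp only [LinearMap.comp_apply, LinearMap.mulLeft_apply] at this
    simp only [Prod.fst_mul, Prod.snd_mul, Subalgebra.coe_mul, mul_assoc]
    rw [hp σ hσ _ (Ideal.mul_mem_left _ _ hb), this]
  add_mem' := fun hp hq σ hσ b hb => by
    simp [add_mul, hp σ hσ b hb, hq σ hσ b hb]
  algebraMap_mem' := fun c σ _ b _ => by
    simp [Algebra.algebraMap_eq_smul_one]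

theorem mem_centerGraph_symm (T : StableTransfer K A B) {z : Subalgebra.center K A}
    {w : Subalgebra.center K B} (h : (z, w) ∈ T.centerGraph) : (w, z) ∈ T.symm.centerGraph :=
  fun τ hτ a ha => by
    have hσ := T.isTraceForm_comp_inv hτ
    calc τ (T.inv (z * a)) = τ (T.inv (z * T.map (T.inv a))) :=
          (T.apply_map_inv (hσ.comp_mulLeft z) ha).symm
      _ = τ (T.inv (T.map (w * T.inv a))) := (h _ hσ _ (T.inv_mem_jacobson ha)).symm
      _ = τ (w * T.inv a) :=
          T.symm.apply_map_inv hτ (Ideal.mul_mem_left _ _ (T.inv_mem_jacobson ha))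

theorem exists_mem_centerGraph (T : StableTransfer K A B) (w : Subalgebra.center K B) :
    ∃ z, (z, w) ∈ T.centerGraph := by
  obtain ⟨z, -, h⟩ := T.exists_map_mul_inv w
  refine ⟨z, fun σ hσ b hb => ?_⟩
  have hτ := (T.isTraceForm_comp_map hσ).comp_mulLeft w
  calc σ (T.map (w * b)) = σ (T.map (w * T.inv (T.map b))) := (T.symm.apply_map_inv hτ hb).symm
    _ = σ (z * T.map b) := h σ hσ _ (T.map_mem_jacobson hb)

theorem mem_annihilator_of_mem_centerGraph (T : StableTransfer K A B) (hB : IsSymmetricAlgebra K B)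
    {z : Subalgebra.center K A} {w : Subalgebra.center K B} (h : (z, w) ∈ T.centerGraph)
    (hz : z ∈ Module.annihilator (Subalgebra.center K A) (Ring.jacobson A)) :
    w ∈ Module.annihilator (Subalgebra.center K B) (Ring.jacobson B) := by
  obtain ⟨-, φ, hφ, nondeg⟩ := hB
  have φ_mul : ∀ b ∈ Ring.jacobson B, φ (w * b) = 0 := fun b hb => by
    have z_mul : (z : A) * T.map b = 0 :=
      congrArg Subtype.val (Module.mem_annihilator.mp hz ⟨_, T.map_mem_jacobson hb⟩)
    calc φ (w * b) = φ (w * T.inv (T.map b)) :=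
          (T.symm.apply_map_inv (IsTraceForm.comp_mulLeft hφ w) hb).symm
      _ = φ (T.inv (z * T.map b)) :=
          (T.mem_centerGraph_symm h φ hφ _ (T.map_mem_jacobson hb)).symm
      _ = 0 := by rw [z_mul, map_zero, map_zero]
  refine Module.mem_annihilator.mpr fun b => Subtype.ext (nondeg _ fun c => ?_)
  exact (congrArg φ (mul_assoc _ _ _)).trans (φ_mul _ (Ideal.mul_mem_right _ _ b.2))

end StableTransfer

theorem StableTransfer.nonempty_center_quotient_equiv (T : StableTransfer K A B)
    (hA : IsSymmetricAlgebra K A) (hB : IsSymmetricAlgebra K B) :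
    Nonempty
      ((Subalgebra.center K A ⧸ Module.annihilator (Subalgebra.center K A) (Ring.jacobson A)) ≃ₐ[K]
        (Subalgebra.center K B ⧸ Module.annihilator (Subalgebra.center K B) (Ring.jacobson B))) :=
  nonempty_quotient_algEquiv_of_graph
    (fun z => (T.symm.exists_mem_centerGraph z).imp fun _ => T.symm.mem_centerGraph_symm)
    T.exists_mem_centerGraph fun _ _ h => ⟨T.mem_annihilator_of_mem_centerGraph hB h,
      T.symm.mem_annihilator_of_mem_centerGraph hA (T.mem_centerGraph_symm h)⟩

end StableCentre

/-! ### Basic algebras -/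

section Basic

theorem IsPrimitiveIdempotent.map_eq_of_mul_eq {R S : Type*} [Ring R] [Ring S] {f : R →+* S}
    (hf : Function.Surjective f) (nil : ∀ x ∈ RingHom.ker f, IsNilpotent x) {e : R}
    (he : IsPrimitiveIdempotent e) {g : S} (hg : IsIdempotentElem g) (hg0 : g ≠ 0)
    (left : f e * g = g) (right : g * f e = g) : f e = g := by
  obtain ⟨e', idem, rfl, mul_e, e_mul⟩ :=
    exists_isIdempotentElem_mul_eq_zero_of_ker_isNilpotent f nil g (hf g) hg (1 - e) he.1.one_sub
      (by rw [map_sub, map_one, mul_sub, mul_one, right, sub_self])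
      (by rw [map_sub, map_one, sub_mul, one_mul, left, sub_self])
  rw [mul_sub, mul_one, sub_eq_zero] at mul_e
  rw [sub_mul, one_mul, sub_eq_zero] at e_mul
  have idem' : IsIdempotentElem (e - e') := by
    rw [IsIdempotentElem, sub_mul, mul_sub, mul_sub, he.1.eq, ← mul_e, ← e_mul, idem.eq]
    abel
  rcases he.2.2 e' (e - e') idem idem' (by rw [mul_sub, ← mul_e, idem.eq, sub_self])
    (by rw [sub_mul, ← e_mul, idem.eq, sub_self]) (add_sub_cancel e' e) with h | h
  · exact absurd (by rw [h, map_zero]) hg0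
  · rw [sub_eq_zero.mp h]

variable {K : Type u} [Field K] {A : Type v} [Ring A] [Algebra K A]

theorem IsPrimitiveIdempotent.exists_map_eq_single {κ : Type*} [DecidableEq κ]
    {ρ : A →ₐ[K] κ → K} (hρ : Function.Surjective ρ) (nil : ∀ x, ρ x = 0 → IsNilpotent x) {e : A}
    (he : IsPrimitiveIdempotent e) : ∃ i, ρ e = Pi.single i 1 := by
  have idem : ρ e * ρ e = ρ e := by rw [← map_mul, he.1.eq]
  obtain ⟨i, hi⟩ : ∃ i, ρ e i ≠ 0 := by
    by_contra! h
    obtain ⟨k, hk⟩ := nil e (funext h)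
    rcases k with - | k
    · exact he.2.1 (by rw [← mul_one e, ← pow_zero e, hk, mul_zero])
    · exact he.2.1 (by rw [← he.1.pow_succ_eq k, hk])
  have hi1 : ρ e i = 1 := mul_right_cancel₀ hi (by rw [one_mul]; exact congrFun idem i)
  have mul_eq : (Pi.single i 1 : κ → K) * ρ e = Pi.single i 1 := by
    rw [← Pi.single_mul_left, hi1, one_mul]
  exact ⟨i, he.map_eq_of_mul_eq (f := (ρ : A →+* κ → K)) hρ nil
    (by rw [IsIdempotentElem, ← Pi.single_mul, one_mul]) (by simp)
    (by simpa [mul_comm] using mul_eq) mul_eq⟩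

theorem exists_splitIdempotents_of_map_eq_single {κ ι : Type*} [Fintype ι] [DecidableEq ι]
    [DecidableEq κ] {ρ : A →ₐ[K] κ → K} (nil : ∀ x, ρ x = 0 → IsNilpotent x) {e : ι → A}
    (he : CompleteOrthogonalIdempotents e) {σ : ι → κ} (hσ : ∀ j, ρ (e j) = Pi.single (σ j) 1) :
    ∃ S : SplitIdempotents K A ι, S.e = e := by
  have inj : Function.Injective σ := fun i j h => by
    by_contra hij
    have : ρ (e i) * ρ (e j) = 0 := by rw [← map_mul, he.ortho hij, map_zero]
    simpa [hσ, h] using congrFun this (σ i)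
  have surj : Function.Surjective σ := fun i => by
    by_contra! h
    have := congrFun (congrArg ρ he.complete) i
    simp [hσ, Pi.single_eq_of_ne (h _).symm] at this
  refine ⟨⟨e, he, fun j => (Pi.evalAlgHom K (fun _ => K) (σ j)).comp ρ, fun i j => ?_,
    fun a ha => nil a (funext fun i => ?_)⟩, rfl⟩
  · simp [hσ, Pi.single_apply, inj.eq_iff]
  · obtain ⟨j, rfl⟩ := surj i
    exact ha j

theorem SplitIdempotents.cartan_det_of_unique {ι : Type*} [Fintype ι] [DecidableEq ι] [Unique ι]
    (S : SplitIdempotents K A ι) : S.cartan.det = Module.finrank K A := by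
  have e_default : S.e default = 1 := by simpa using S.complete.complete
  have peirce_one : peirce K (1 : A) 1 = ⊤ := by
    rw [peirce, LinearMap.mulLeft_one, LinearMap.mulRight_one, LinearMap.comp_id,
      LinearMap.range_id]
  rw [Matrix.det_unique, cartan, Matrix.of_apply, e_default, peirce_one, finrank_top]

variable [FiniteDimensional K A]

theorem IsBasic.exists_algHom (h : IsBasic K A) :
    ∃ (n : ℕ) (ρ : A →ₐ[K] Fin n → K), Function.Surjective ρ ∧ ∀ a, ρ a = 0 → IsNilpotent a := by
  obtain ⟨n, ⟨ψ⟩⟩ := h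
  refine ⟨n, ψ.toAlgHom.comp (Ideal.Quotient.mkₐ K (Ring.jacobson A)),
    ψ.surjective.comp (Ideal.Quotient.mkₐ_surjective K _), fun a ha => ?_⟩
  exact isNilpotent_of_mem_jacobson K
    (Ideal.Quotient.eq_zero_iff_mem.mp ((map_eq_zero_iff ψ ψ.injective).mp ha))

theorem IsBasic.exists_splitIdempotents (h : IsBasic K A) :
    ∃ n : ℕ, Nonempty (SplitIdempotents K A (Fin n)) := by
  obtain ⟨n, ρ, hρ, nil⟩ := h.exists_algHom
  obtain ⟨e, he, hρe⟩ := CompleteOrthogonalIdempotents.lift_of_isNilpotent_ker (ρ : A →+* Fin n → K)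
    nil (CompleteOrthogonalIdempotents.single fun _ => K) fun i => hρ _
  obtain ⟨S, -⟩ := exists_splitIdempotents_of_map_eq_single nil he (σ := id) (congrFun hρe)
  exact ⟨n, ⟨S⟩⟩

theorem HasCartanMatrix.exists_splitIdempotents {n : ℕ} {C : Matrix (Fin n) (Fin n) ℕ}
    (hC : HasCartanMatrix K A C) (h : IsBasic K A) :
    ∃ S : SplitIdempotents K A (Fin n), S.cartan = C.map (↑) := by
  obtain ⟨e, he, prim, finrank_eq⟩ := hC
  obtain ⟨_, ρ, hρ, nil⟩ := h.exists_algHom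
  choose σ hσ using fun i => (prim i).exists_map_eq_single hρ nil
  obtain ⟨S, rfl⟩ := exists_splitIdempotents_of_map_eq_single nil he hσ
  exact ⟨S, by ext i j; simp [SplitIdempotents.cartan, finrank_eq]⟩

end Basic

/-! ### The Reynolds ideal -/

section Reynolds

theorem mem_socle_iff {R : Type*} [Ring R] [IsSemisimpleRing (R ⧸ Ring.jacobson R)] {x : R} :
    x ∈ socle R ↔ ∀ a ∈ Ring.jacobson R, a * x = 0 := by
  let T : Submodule R R :=
    { carrier := {x | ∀ a ∈ Ring.jacobson R, a * x = 0}
      add_mem' := fun hx hy a ha => by rw [mul_add, hx a ha, hy a ha, add_zero]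
      zero_mem' := fun a _ => mul_zero a
      smul_mem' := fun b x hx a ha => by
        rw [smul_eq_mul, ← mul_assoc]
        exact hx _ (Ideal.mul_mem_right _ _ ha) }
  have torsion : Module.IsTorsionBySet R T (Ring.jacobson R) := fun x a => Subtype.ext (x.2 a a.2)
  have semisimple : IsSemisimpleModule R T :=
    letI := torsion.module
    torsion.isSemisimpleModule_iff.mp inferInstance
  suffices socle R = T by rw [this]; rfl
  refine le_antisymm (sSup_le fun S (hS : IsSimpleModule R S) x hx a ha => ?_) ?_
  · exact congrArg Subtype.val (Module.mem_annihilator.mp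
      (IsSemisimpleModule.jacobson_le_annihilator R S ha) ⟨x, hx⟩)
  · rw [← T.range_subtype, LinearMap.range_eq_map, ← IsSemisimpleModule.sSup_simples_eq_top R T,
      (Submodule.gc_map_comap T.subtype).l_sSup]
    exact iSup₂_le fun S (hS : IsSimpleModule R S) => le_sSup
      (IsSimpleModule.congr (Submodule.equivMapOfInjective _ T.subtype_injective S).symm)

variable {K : Type u} [Field K] {A : Type v} [Ring A] [Algebra K A] [FiniteDimensional K A]

theorem coe_mem_reynoldsIdeal_iff {z : Subalgebra.center K A} : (z : A) ∈ reynoldsIdeal K A ↔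
    z ∈ Module.annihilator (Subalgebra.center K A) (Ring.jacobson A) := by
  have : IsArtinianRing A := isArtinian_of_tower K inferInstance
  have : (z : A) ∈ reynoldsIdeal K A ↔ (z : A) ∈ socle A := and_iff_right z.2
  rw [this, mem_socle_iff, Module.mem_annihilator]
  simp [Subtype.ext_iff, Subalgebra.mem_center_iff.mp z.2, Subalgebra.smul_def]

theorem IsSymmetricAlgebra.exists_dual_equiv (hA : IsSymmetricAlgebra K A) :
    ∃ E : Module.Dual K A ≃ₗ[K] A, ∀ f, IsTraceForm f → (∀ a ∈ Ring.jacobson A, f a = 0) →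
      E f ∈ reynoldsIdeal K A := by
  obtain ⟨-, φ, hφ, nondeg⟩ := hA
  have inj : Function.Injective ((LinearMap.mul K A).compr₂ φ) :=
    (injective_iff_map_eq_zero _).mpr fun a ha => nondeg a fun b => LinearMap.congr_fun ha b
  let Φ := LinearEquiv.ofInjectiveOfFinrankEq _ inj Subspace.dual_finrank_eq.symm
  let E := Φ.symm
  have φ_mul : ∀ f b, φ (E f * b) = f b := fun f => LinearMap.congr_fun (Φ.apply_symm_apply f)
  refine ⟨E, fun f hf hJ => ?_⟩
  have central : E f ∈ Subalgebra.center K A := Subalgebra.mem_center_iff.mpr fun a =>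
    sub_eq_zero.mp (nondeg _ fun b => by
      rw [sub_mul, map_sub, mul_assoc, hφ, mul_assoc, mul_assoc, φ_mul, φ_mul, hf, sub_self])
  rw [← Subtype.coe_mk (E f) central, coe_mem_reynoldsIdeal_iff, Module.mem_annihilator]
  refine fun j => Subtype.ext (nondeg _ fun b => ?_)
  change φ (E f * j * b) = 0
  rw [mul_assoc, φ_mul, hJ _ (Ideal.mul_mem_right _ _ j.2)]

theorem SplitIdempotents.card_le_finrank_reynoldsIdeal {ι : Type*} [Fintype ι] [DecidableEq ι]
    (S : SplitIdempotents K A ι) (hA : IsSymmetricAlgebra K A) :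
    Fintype.card ι ≤ Module.finrank K (reynoldsIdeal K A) := by
  obtain ⟨E, hE⟩ := hA.exists_dual_equiv
  have indep : LinearIndependent K fun i => E (S.π i).toLinearMap :=
    (Fintype.linearIndependent_iff.mpr fun g hg j => by
      simpa [S.π_e] using LinearMap.congr_fun hg (S.e j)).map' _ E.ker
  rw [← finrank_span_eq_card indep]
  refine Submodule.finrank_mono (Submodule.span_le.mpr ?_)
  rintro _ ⟨i, rfl⟩
  refine hE _ (fun a b => by simp [mul_comm]) fun a ha => ?_
  exact ((isNilpotent_of_mem_jacobson K ha).map (S.π i)).eq_zero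

theorem IsBasic.exists_splitIdempotents_unit (h : IsBasic K A) (hA : IsSymmetricAlgebra K A)
    [Nontrivial A] {r : A} (hr : reynoldsIdeal K A = Submodule.span K {r}) :
    ∃ S : SplitIdempotents K A (Fin 1), S.cartan.det = Module.finrank K A := by
  obtain ⟨n, ⟨S⟩⟩ := h.exists_splitIdempotents
  have n_le : n ≤ 1 := by
    have := S.card_le_finrank_reynoldsIdeal hA
    rw [hr, Fintype.card_fin] at this
    exact this.trans ((finrank_span_le_card {r}).trans (by simp))
  have n_ne : n ≠ 0 := by
    rintro rfl
    simpa using S.complete.complete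
  obtain rfl : n = 1 := by omega
  exact ⟨S, S.cartan_det_of_unique⟩

end Reynolds

/-! ### Wedges of truncated polynomial algebras -/

section Wedge

variable {ι : Type*}

/-- The relations `xᵢ ^ pᵢ = 0` and `xᵢ xⱼ = 0` for `i ≠ j`. -/
def wedgeRels (K : Type*) [Field K] (p : ι → ℕ) : Set (MvPolynomial ι K) :=
  {f | ∃ i, MvPolynomial.X i ^ p i = f} ∪
    {f | ∃ i j, i ≠ j ∧ MvPolynomial.X i * MvPolynomial.X j = f}

/-- The algebra `K[xᵢ] / (xᵢ ^ pᵢ, xᵢ xⱼ)`. For the three classes of algebras it is the centre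
modulo the Reynolds ideal. -/
abbrev WedgeAlgebra (K : Type*) [Field K] (p : ι → ℕ) : Type _ :=
  MvPolynomial ι K ⧸ Ideal.span (wedgeRels K p)

namespace WedgeAlgebra

variable (K : Type*) [Field K] (p : ι → ℕ)

/-- The class of `xᵢ` in `K[xᵢ] / (xᵢ ^ pᵢ, xᵢ xⱼ)`. -/
noncomputable def gen (i : ι) : WedgeAlgebra K p :=
  Ideal.Quotient.mk _ (MvPolynomial.X i)

theorem gen_pow (i : ι) : gen K p i ^ p i = 0 :=
  Ideal.Quotient.eq_zero_iff_mem.mpr (Ideal.subset_span (Or.inl ⟨i, rfl⟩))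

variable {i j : ι} in
theorem gen_mul_gen (h : i ≠ j) : gen K p i * gen K p j = 0 :=
  Ideal.Quotient.eq_zero_iff_mem.mpr (Ideal.subset_span (Or.inr ⟨i, j, h, rfl⟩))

variable {i j : ι} {m n : ℕ} in
theorem gen_pow_mul_gen_pow (h : i ≠ j) (hm : m ≠ 0) (hn : n ≠ 0) :
    gen K p i ^ m * gen K p j ^ n = 0 :=
  zero_dvd_iff.mp (gen_mul_gen K p h ▸ mul_dvd_mul (dvd_pow_self _ hm) (dvd_pow_self _ hn))

theorem adjoin_range_gen : Algebra.adjoin K (Set.range (gen K p)) = ⊤ := by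
  have : Set.range (gen K p) =
      Ideal.Quotient.mkₐ K (Ideal.span (wedgeRels K p)) '' Set.range MvPolynomial.X := by
    rw [← Set.range_comp]
    rfl
  rw [this, ← AlgHom.map_adjoin, MvPolynomial.adjoin_range_X, Algebra.map_top,
    AlgHom.range_eq_top]
  exact Ideal.Quotient.mkₐ_surjective K _

section Lift

variable {p} {S : Type*} [CommRing S] [Algebra K S] (y : ι → S) (pow : ∀ i, y i ^ p i = 0)
  (mul : ∀ i j, i ≠ j → y i * y j = 0)

/-- The algebra homomorphism out of `K[xᵢ] / (xᵢ ^ pᵢ, xᵢ xⱼ)` with `xᵢ ↦ yᵢ`. -/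
noncomputable def lift : WedgeAlgebra K p →ₐ[K] S :=
  Ideal.Quotient.liftₐ _ (MvPolynomial.aeval y) fun f hf => by
    suffices Ideal.span (wedgeRels K p) ≤ RingHom.ker (MvPolynomial.aeval (R := K) y) from this hf
    rw [Ideal.span_le]
    rintro _ (⟨i, rfl⟩ | ⟨i, j, hij, rfl⟩)
    · simp [pow]
    · simp [mul i j hij]

theorem lift_gen (i : ι) : lift K y pow mul (gen K p i) = y i :=
  (Ideal.Quotient.liftₐ_apply _ _ _ _).trans (MvPolynomial.aeval_X y i)

end Lift

variable {K p} in
/-- The generators outside the range of `x` are superfluous. -/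
theorem nonempty_quotient_algEquiv {σ : Type*} {I : Ideal (MvPolynomial σ K)} (x : ι → σ)
    (g : σ → WedgeAlgebra K p) (le_ker : I ≤ RingHom.ker (MvPolynomial.aeval g))
    (g_x : ∀ i, g (x i) = gen K p i) (pow : ∀ i, MvPolynomial.X (x i) ^ p i ∈ I)
    (mul : ∀ i j, i ≠ j → MvPolynomial.X (x i) * MvPolynomial.X (x j) ∈ I)
    (mem : ∀ t ∉ Set.range x, MvPolynomial.X t ∈ I) :
    Nonempty ((MvPolynomial σ K ⧸ I) ≃ₐ[K] WedgeAlgebra K p) := by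
  let mk := Ideal.Quotient.mkₐ K I
  have mk_eq_zero {f} : f ∈ I → mk f = 0 := Ideal.Quotient.eq_zero_iff_mem.mpr
  let F : (MvPolynomial σ K ⧸ I) →ₐ[K] WedgeAlgebra K p :=
    Ideal.Quotient.liftₐ I (MvPolynomial.aeval g) le_ker
  let G : WedgeAlgebra K p →ₐ[K] (MvPolynomial σ K ⧸ I) :=
    lift K (fun i => mk (MvPolynomial.X (x i))) (fun i => (map_pow mk _ _).symm.trans
      (mk_eq_zero (pow i))) fun i j hij => (map_mul mk _ _).symm.trans (mk_eq_zero (mul i j hij))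
  have G_gen (i) : G (gen K p i) = mk (MvPolynomial.X (x i)) := lift_gen ..
  have F_mk (t) : F (mk (MvPolynomial.X t)) = g t := MvPolynomial.aeval_X g t
  refine ⟨AlgEquiv.ofAlgHom F G ?_ ?_⟩
  · refine AlgHom.ext_of_adjoin_eq_top (adjoin_range_gen K p) ?_
    rintro _ ⟨i, rfl⟩
    simp [G_gen, F_mk, g_x]
  · refine Ideal.Quotient.algHom_ext _ (MvPolynomial.algHom_ext fun t => ?_)
    change G (F (mk (MvPolynomial.X t))) = mk (MvPolynomial.X t)
    by_cases ht : t ∈ Set.range x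
    · obtain ⟨i, rfl⟩ := ht
      rw [F_mk, g_x, G_gen]
    · rw [mk_eq_zero (mem t ht), map_zero, map_zero]

/-- The span of the powers `xᵢ ^ m` with `k ≤ m`; for positive `k` it is the `k`-th power of the
nilradical. -/
noncomputable def powerSpan (k : ℕ) : Submodule K (WedgeAlgebra K p) :=
  Submodule.span K {z | ∃ i m, k ≤ m ∧ gen K p i ^ m = z}

theorem powerSpan_mul (k l : ℕ) :
    powerSpan K p (k + 1) * powerSpan K p (l + 1) = powerSpan K p (k + 1 + (l + 1)) := by
  rw [powerSpan, powerSpan, Submodule.span_mul_span]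
  refine le_antisymm (Submodule.span_le.mpr ?_) (Submodule.span_mono ?_)
  · rintro _ ⟨_, ⟨i, m, hm, rfl⟩, _, ⟨j, n, hn, rfl⟩, rfl⟩
    change gen K p i ^ m * gen K p j ^ n ∈ powerSpan K p _
    obtain rfl | hij := eq_or_ne i j
    · exact Submodule.subset_span ⟨i, m + n, by omega, pow_add _ _ _⟩
    · rw [gen_pow_mul_gen_pow K p hij (by omega) (by omega)]
      exact zero_mem _
  · rintro _ ⟨i, m, hm, rfl⟩
    exact ⟨_, ⟨i, k + 1, le_rfl, rfl⟩, _, ⟨i, m - (k + 1), by omega, rfl⟩,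
      (pow_add _ _ _).symm.trans (by congr 1; omega)⟩

theorem exists_sub_algebraMap_mem_powerSpan (z : WedgeAlgebra K p) :
    ∃ c : K, z - algebraMap K _ c ∈ powerSpan K p 1 := by
  have hz : z ∈ Algebra.adjoin K (Set.range (gen K p)) := adjoin_range_gen K p ▸ trivial
  induction hz using Algebra.adjoin_induction with
  | mem z hz =>
    obtain ⟨i, rfl⟩ := hz
    refine ⟨0, ?_⟩
    rw [map_zero, sub_zero]
    exact Submodule.subset_span ⟨i, 1, le_rfl, pow_one _⟩
  | algebraMap c => exact ⟨c, by simp⟩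
  | add z w _ _ hz hw =>
    obtain ⟨c, hc⟩ := hz
    obtain ⟨d, hd⟩ := hw
    exact ⟨c + d, by rw [map_add, add_sub_add_comm]; exact add_mem hc hd⟩
  | mul z w _ _ hz hw =>
    obtain ⟨c, hc⟩ := hz
    obtain ⟨d, hd⟩ := hw
    refine ⟨c * d, ?_⟩
    have hcd : (z - algebraMap K _ c) * (w - algebraMap K _ d) ∈ powerSpan K p 1 := by
      have : powerSpan K p 2 ≤ powerSpan K p 1 :=
        Submodule.span_mono fun _ ⟨i, m, hm, h⟩ => ⟨i, m, by omega, h⟩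
      exact this (powerSpan_mul K p 0 0 ▸ Submodule.mul_mem_mul hc hd)
    have smul_mem {a : K} {v} (hv : v ∈ powerSpan K p 1) : algebraMap K _ a * v ∈ powerSpan K p 1 :=
      Algebra.smul_def a v ▸ Submodule.smul_mem _ a hv
    convert add_mem hcd (add_mem (smul_mem (a := c) hd) (smul_mem (a := d) hc)) using 1
    rw [map_mul]
    ring

theorem restrictScalars_nilradical [Nontrivial (WedgeAlgebra K p)] :
    (nilradical (WedgeAlgebra K p)).restrictScalars K = powerSpan K p 1 := by
  have le : powerSpan K p 1 ≤ (nilradical (WedgeAlgebra K p)).restrictScalars K := by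
    refine Submodule.span_le.mpr ?_
    rintro _ ⟨i, m, hm, rfl⟩
    exact Ideal.pow_mem_of_mem _ (mem_nilradical.mpr ⟨p i, gen_pow K p i⟩) m hm
  refine le_antisymm (fun z hz => ?_) le
  obtain ⟨c, hc⟩ := exists_sub_algebraMap_mem_powerSpan K p z
  have nil : IsNilpotent (algebraMap K (WedgeAlgebra K p) c) := by
    rw [← mem_nilradical, ← sub_sub_cancel z (algebraMap K _ c)]
    exact sub_mem hz (le hc)
  have hc0 : c = 0 :=
    ((IsNilpotent.map_iff (algebraMap K (WedgeAlgebra K p)).injective).mp nil).eq_zero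
  simpa [hc0] using hc

theorem restrictScalars_nilradical_pow [Nontrivial (WedgeAlgebra K p)] (k : ℕ) :
    (nilradical (WedgeAlgebra K p) ^ (k + 1)).restrictScalars K = powerSpan K p (k + 1) := by
  rw [Submodule.restrictScalars_pow k.succ_ne_zero, restrictScalars_nilradical]
  induction k with
  | zero => rw [pow_one]
  | succ k ih => rw [pow_succ, ih, powerSpan_mul K p k 0]

variable {p} (hp : ∀ i, p i ≠ 0)
include hp

theorem exists_dual_gen_pow {i : ι} {m : ℕ} (hm : m < p i) :
    ∃ f : Module.Dual K (WedgeAlgebra K p), f (gen K p i ^ m) = 1 ∧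
      ∀ j n, n ≠ 0 → j ≠ i ∨ n ≠ m → f (gen K p j ^ n) = 0 := by
  classical
  let q : Polynomial K := Polynomial.X ^ p i
  let ev : WedgeAlgebra K p →ₐ[K] Polynomial K ⧸ Ideal.span {q} :=
    lift K (Pi.single i (Ideal.Quotient.mk _ Polynomial.X)) (fun j => by
      obtain rfl | hj := eq_or_ne j i
      · rw [Pi.single_eq_same, ← map_pow]
        exact Ideal.Quotient.eq_zero_iff_mem.mpr (Ideal.mem_span_singleton_self q)
      · rw [Pi.single_eq_of_ne hj, zero_pow (hp j)]) fun j l hjl => by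
      obtain rfl | hj := eq_or_ne j i
      · rw [Pi.single_eq_of_ne hjl.symm, mul_zero]
      · rw [Pi.single_eq_of_ne hj, zero_mul]
  let coeff : (Polynomial K ⧸ Ideal.span {q}) →ₗ[K] K :=
    ((Ideal.span {q}).restrictScalars K).liftQ (Polynomial.lcoeff K m) fun f hf =>
      Polynomial.X_pow_dvd_iff.mp (Ideal.mem_span_singleton.mp hf) m hm
  have coeff_mk (g) : coeff (Ideal.Quotient.mk _ g) = g.coeff m := rfl
  refine ⟨coeff ∘ₗ ev.toLinearMap, ?_, fun j n hn hjn => ?_⟩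
  · simp only [LinearMap.comp_apply, AlgHom.toLinearMap_apply, map_pow, ev, lift_gen,
      Pi.single_eq_same]
    rw [← map_pow, coeff_mk, Polynomial.coeff_X_pow_self]
  · simp only [LinearMap.comp_apply, AlgHom.toLinearMap_apply, map_pow, ev, lift_gen]
    obtain rfl | hj := eq_or_ne j i
    · rw [Pi.single_eq_same, ← map_pow, coeff_mk, Polynomial.coeff_X_pow,
        if_neg (hjn.resolve_left (· rfl)).symm]
    · rw [Pi.single_eq_of_ne hj, zero_pow hn, map_zero]

theorem linearIndependent_gen_pow {s : Finset (Σ _ : ι, ℕ)} (hs : ∀ t ∈ s, t.2 ≠ 0 ∧ t.2 < p t.1) :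
    LinearIndependent K fun t : s => gen K p t.1.1 ^ t.1.2 := by
  choose f f_self f_ne using fun t : s => exists_dual_gen_pow K hp (hs t t.2).2
  refine .of_pairwise_dual_eq_zero_one _ f (fun t u htu => f_ne t _ _ (hs u u.2).1 ?_) f_self
  contrapose! htu
  exact Subtype.ext (Sigma.ext htu.1.symm (heq_of_eq htu.2.symm))

theorem finrank_nilradical_pow [Fintype ι] {k : ℕ} (hk : 1 ≤ k) :
    Module.finrank K ↥(nilradical (WedgeAlgebra K p) ^ k) = ∑ i, (p i - k) := by
  obtain ⟨k, rfl⟩ := Nat.exists_eq_add_of_le' hk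
  have : Nontrivial (WedgeAlgebra K p) :=
    RingHom.domain_nontrivial
      (lift K (0 : ι → K) (fun i => zero_pow (hp i)) fun _ _ _ => zero_mul _).toRingHom
  have span_eq : powerSpan K p (k + 1) = Submodule.span K (Set.range
      fun t : Finset.univ.sigma fun i => Finset.Ico (k + 1) (p i) => gen K p t.1.1 ^ t.1.2) := by
    refine le_antisymm (Submodule.span_le.mpr ?_) (Submodule.span_mono ?_)
    · rintro _ ⟨i, m, hm, rfl⟩
      by_cases h : m < p i
      · exact Submodule.subset_span ⟨⟨⟨i, m⟩, by simp [hm, h]⟩, rfl⟩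
      · rw [pow_eq_zero_of_le (not_lt.mp h) (gen_pow K p i)]
        exact zero_mem _
    · rintro _ ⟨⟨⟨i, m⟩, h⟩, rfl⟩
      exact ⟨i, m, (Finset.mem_Ico.mp (Finset.mem_sigma.mp h).2).1, rfl⟩
  change Module.finrank K ((nilradical (WedgeAlgebra K p) ^ (k + 1)).restrictScalars K) = _
  rw [restrictScalars_nilradical_pow, span_eq,
    finrank_span_eq_card (linearIndependent_gen_pow K hp fun t ht => ?_), Fintype.card_coe,
    Finset.card_sigma]
  · simp only [Nat.card_Ico]
  · have := Finset.mem_Ico.mp (Finset.mem_sigma.mp ht).2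
    omega

end WedgeAlgebra

theorem finrank_nilradical_pow_congr {K R S : Type*} [Field K] [CommRing R] [Algebra K R]
    [CommRing S] [Algebra K S] (e : R ≃ₐ[K] S) (k : ℕ) :
    Module.finrank K ↥(nilradical R ^ k) = Module.finrank K ↥(nilradical S ^ k) := by
  have comap_nilradical : nilradical R = (nilradical S).comap e := by
    ext x
    rw [Ideal.mem_comap, mem_nilradical, mem_nilradical, IsNilpotent.map_iff e.injective]
  have map_pow_nilradical : (nilradical S ^ k).restrictScalars K =
      ((nilradical R ^ k).restrictScalars K).map e.toLinearEquiv.toLinearMap := by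
    ext x
    rw [← Ideal.map_comap_of_surjective e e.surjective (nilradical S), ← comap_nilradical,
      ← Ideal.map_pow, Submodule.restrictScalars_mem,
      Ideal.mem_map_iff_of_surjective _ e.surjective]
    rfl
  change Module.finrank K ((nilradical R ^ k).restrictScalars K) =
    Module.finrank K ((nilradical S ^ k).restrictScalars K)
  rw [map_pow_nilradical, LinearEquiv.finrank_map_eq]

section Fintype

variable [Fintype ι] {p q : ι → ℕ}

/-- Second differences: as a function of `a`, `p - (a + 1)` has a kink exactly at `p = a + 1`. -/
theorem count_map_add_two_mul_sum_tsub (p : ι → ℕ) (a : ℕ) :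
    (Finset.univ.val.map p).count (a + 1) + 2 * ∑ i, (p i - (a + 1)) =
      ∑ i, (p i - a) + ∑ i, (p i - (a + 2)) := by
  have kink (i) : (if a + 1 = p i then 1 else 0) + 2 * (p i - (a + 1)) =
      (p i - a) + (p i - (a + 2)) := by split_ifs <;> omega
  rw [← Finset.sum_add_distrib, ← Finset.sum_congr rfl fun i _ => kink i, Finset.sum_add_distrib,
    Finset.mul_sum, Multiset.count_map, ← Finset.card_filter]
  rfl

theorem prod_eq_of_sum_tsub_eq (hp : ∀ i, p i ≠ 0) (hq : ∀ i, q i ≠ 0)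
    (h : ∀ k, 1 ≤ k → ∑ i, (p i - k) = ∑ i, (q i - k)) : ∏ i, p i = ∏ i, q i := by
  have sum_eq (p : ι → ℕ) (hp : ∀ i, p i ≠ 0) : ∑ i, p i = ∑ i, (p i - 1) + Fintype.card ι := by
    rw [Fintype.card_eq_sum_ones, ← Finset.sum_add_distrib]
    exact Finset.sum_congr rfl fun i _ => (Nat.succ_pred (hp i)).symm
  have h' (k) : ∑ i, (p i - k) = ∑ i, (q i - k) := by
    obtain rfl | hk := Nat.eq_zero_or_pos k
    · simp only [Nat.sub_zero, sum_eq p hp, sum_eq q hq, h 1 le_rfl]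
    · exact h k hk
  suffices Finset.univ.val.map p = Finset.univ.val.map q from congrArg Multiset.prod this
  ext (_ | a)
  · rw [Multiset.count_eq_zero_of_notMem (by simpa using hp),
      Multiset.count_eq_zero_of_notMem (by simpa using hq)]
  · have hpa := count_map_add_two_mul_sum_tsub p a
    rw [h', h', h', ← count_map_add_two_mul_sum_tsub q a] at hpa
    exact Nat.add_right_cancel hpa

theorem WedgeAlgebra.prod_eq_of_algEquiv {K : Type*} [Field K] (hp : ∀ i, p i ≠ 0)
    (hq : ∀ i, q i ≠ 0) (e : WedgeAlgebra K p ≃ₐ[K] WedgeAlgebra K q) : ∏ i, p i = ∏ i, q i :=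
  prod_eq_of_sum_tsub_eq hp hq fun k hk => by
    rw [← finrank_nilradical_pow K hp hk, finrank_nilradical_pow_congr e,
      finrank_nilradical_pow K hq hk]

end Fintype

end Wedge

/-! ### The ratio of the Cartan determinant for the three classes -/

section Classes

variable {K : Type u} [Field K] {A : Type v} [Ring A] [Algebra K A]

theorem HasCentreAndReynolds.nonempty_quotient_algEquiv [FiniteDimensional K A] {σ : Type}
    {rels gens : Set (MvPolynomial σ K)} (h : HasCentreAndReynolds K A rels gens) :
    Nonempty ((Subalgebra.center K A ⧸
        Module.annihilator (Subalgebra.center K A) (Ring.jacobson A)) ≃ₐ[K]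
      MvPolynomial σ K ⧸ Ideal.span (rels ∪ gens)) := by
  obtain ⟨φ, hφ⟩ := h
  let mk := Ideal.Quotient.mkₐ K (Ideal.span rels)
  have annihilator_eq : Module.annihilator (Subalgebra.center K A) (Ring.jacobson A) =
      ((Ideal.span gens).map mk).map (φ : _ →+* Subalgebra.center K A) := by
    rw [Ideal.map_span, Ideal.map_span]
    have span_eq : reynoldsIdeal K A = (Submodule.span K (φ ∘ mk '' gens)).map
        (Subalgebra.center K A).val.toLinearMap := by
      rw [hφ, Submodule.map_span, ← Set.image_comp]
      rfl
    refine le_antisymm (fun z hz => ?_) (Ideal.span_le.mpr ?_)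
    · rw [← coe_mem_reynoldsIdeal_iff, span_eq] at hz
      obtain ⟨w, hw, hwz⟩ := hz
      obtain rfl : w = z := Subtype.ext hwz
      rw [← Set.image_comp]
      exact Submodule.span_le_restrictScalars K _ _ hw
    · rw [← Set.image_comp]
      intro z hz
      refine coe_mem_reynoldsIdeal_iff.mp ?_
      rw [span_eq]
      exact ⟨z, Submodule.subset_span hz, rfl⟩
  exact ⟨((Ideal.quotientEquivAlg _ _ φ annihilator_eq).symm.trans
    (DoubleQuot.quotQuotEquivQuotSupₐ K _ _)).trans
      (Ideal.quotientEquivAlgOfEq K (Ideal.span_union _ _).symm)⟩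

variable (K A) in
/-- Up to the factor `c`, the Cartan determinant of `A` is the product of the exponents `pᵢ` in a
presentation `K[x₀, x₁, x₂] / (xᵢ ^ pᵢ, xᵢ xⱼ)` of the centre modulo the Reynolds ideal. The
latter is written as the annihilator of the radical in the centre. -/
def HasCartanDetRatio (c : ℤ) : Prop :=
  ∃ (n : ℕ) (S : SplitIdempotents K A (Fin n)) (p : Fin 3 → ℕ), (∀ i, p i ≠ 0) ∧
    Nonempty ((Subalgebra.center K A ⧸
      Module.annihilator (Subalgebra.center K A) (Ring.jacobson A)) ≃ₐ[K] WedgeAlgebra K p) ∧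
    S.cartan.det = c * ∏ i, p i

theorem HasCartanDetRatio.dvd {B : Type w} [Ring B] [Algebra K B] {c d : ℤ}
    (hc : HasCartanDetRatio K A c) (hd : HasCartanDetRatio K B d) (c_ne : c ≠ 0)
    (hA : IsSymmetricAlgebra K A) (hB : IsSymmetricAlgebra K B)
    (h : StablyEquivalentOfMoritaType K A B) : c ∣ d := by
  have := hA.1
  have := hB.1
  obtain ⟨_, S, p, hp, ⟨e⟩, det_S⟩ := hc
  obtain ⟨_, S', q, hq, ⟨e'⟩, det_S'⟩ := hd
  obtain ⟨T⟩ := h.nonempty_stableTransfer S S'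
  obtain ⟨E⟩ := T.nonempty_center_quotient_equiv hA hB
  have prod_ne : (∏ i, (p i : ℤ)) ≠ 0 :=
    Finset.prod_ne_zero_iff.mpr fun i _ => Nat.cast_ne_zero.mpr (hp i)
  have prod_eq : ∏ i, p i = ∏ i, q i :=
    WedgeAlgebra.prod_eq_of_algEquiv hp hq ((e.symm.trans E).trans e')
  have det_dvd := h.det_cartan_dvd S S' (by rw [det_S]; push_cast; exact mul_ne_zero c_ne prod_ne)
  rw [det_S, det_S', ← prod_eq] at det_dvd
  push_cast at det_dvd
  exact Int.dvd_of_mul_dvd_mul_right prod_ne det_dvd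

/-- The relations are shown to lie in an arbitrary ideal `I`, which keeps the span of `rels ∪ gens`
out of sight of `simp`. -/
theorem HasCentreAndReynolds.nonempty_wedge_algEquiv [FiniteDimensional K A] {σ : Type}
    {rels gens : Set (MvPolynomial σ K)} (h : HasCentreAndReynolds K A rels gens) {p : Fin 3 → ℕ}
    (x : Fin 3 → σ) (g : σ → WedgeAlgebra K p)
    (aeval_eq_zero : ∀ f ∈ rels ∪ gens, MvPolynomial.aeval g f = 0)
    (g_x : ∀ i, g (x i) = WedgeAlgebra.gen K p i)
    (mem : ∀ I : Ideal (MvPolynomial σ K), (∀ f ∈ rels ∪ gens, f ∈ I) →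
      (∀ i, MvPolynomial.X (x i) ^ p i ∈ I) ∧
      (∀ i j, i < j → MvPolynomial.X (x i) * MvPolynomial.X (x j) ∈ I) ∧
      ∀ t ∉ Set.range x, MvPolynomial.X t ∈ I) :
    Nonempty ((Subalgebra.center K A ⧸
      Module.annihilator (Subalgebra.center K A) (Ring.jacobson A)) ≃ₐ[K] WedgeAlgebra K p) := by
  obtain ⟨e⟩ := h.nonempty_quotient_algEquiv
  obtain ⟨pow_mem, mul_mem, X_mem⟩ := mem _ fun f hf => Ideal.subset_span hf
  refine (WedgeAlgebra.nonempty_quotient_algEquiv x g (Ideal.span_le.mpr aeval_eq_zero) g_x pow_mem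
    (fun i j hij => ?_) X_mem).map e.trans
  obtain hij | hji := hij.lt_or_gt
  · exact mul_mem i j hij
  · rw [mul_comm]
    exact mul_mem j i hji

open MvPolynomial in
theorem IsTypeThree.nonempty_algEquiv {a b c : ℕ} (h : IsTypeThree K A a b c) :
    Nonempty ((Subalgebra.center K A ⧸
      Module.annihilator (Subalgebra.center K A) (Ring.jacobson A)) ≃ₐ[K]
        WedgeAlgebra K ![a, b, c]) := by
  have := h.symmetric.1
  let y := WedgeAlgebra.gen K ![a, b, c]
  have ya : y 0 ^ a = 0 := WedgeAlgebra.gen_pow K _ 0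
  have yb : y 1 ^ b = 0 := WedgeAlgebra.gen_pow K _ 1
  have yc : y 2 ^ c = 0 := WedgeAlgebra.gen_pow K _ 2
  have y_mul {i j} : i ≠ j → y i * y j = 0 := WedgeAlgebra.gen_mul_gen K _
  refine h.centre.nonempty_wedge_algEquiv ![0, 1, 2] ![y 0, y 1, y 2, 0, 0, 0]
    (by simp [threeRels, pow_succ, ya, yb, yc, y_mul]) (by simp [Fin.forall_fin_succ, y])
    fun I hI => ?_
  simp only [threeRels, Set.mem_union, Set.mem_insert_iff, Set.mem_singleton_iff, or_imp,
    forall_and, forall_eq] at hI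
  obtain ⟨⟨-, -, -, hA, hB, hC, -, -, -, -, -, -, -, -, -, -, -, -, -, -, -, hAB, hAC, hBC⟩,
    h3, h4, h5⟩ := hI
  simp only [Submodule.sub_mem_iff_left, h3, h4, h5] at hA hB hC
  simp [Fin.forall_fin_succ, *]

open MvPolynomial in
theorem IsTypeTwo.nonempty_algEquiv {k s : ℕ} (h : IsTypeTwo K A k s) :
    Nonempty ((Subalgebra.center K A ⧸
      Module.annihilator (Subalgebra.center K A) (Ring.jacobson A)) ≃ₐ[K]
        WedgeAlgebra K ![k, s, 2]) := by
  have := h.symmetric.1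
  let y := WedgeAlgebra.gen K ![k, s, 2]
  have yk : y 0 ^ k = 0 := WedgeAlgebra.gen_pow K _ 0
  have ys : y 1 ^ s = 0 := WedgeAlgebra.gen_pow K _ 1
  have yt : y 2 ^ 2 = 0 := WedgeAlgebra.gen_pow K _ 2
  have y_mul {i j} : i ≠ j → y i * y j = 0 := WedgeAlgebra.gen_mul_gen K _
  by_cases char_two : CharP K 2
  · refine (h.centre_of_char_two char_two).nonempty_wedge_algEquiv ![0, 1, 3]
      ![y 0, y 1, 0, y 2] (by simp [twoRelsCharTwo, yk, ys, yt, y_mul])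
      (by simp [Fin.forall_fin_succ, y]) fun I hI => ?_
    simp only [twoRelsCharTwo, Set.mem_union, Set.mem_insert_iff, Set.mem_singleton_iff, or_imp,
      forall_and, forall_eq] at hI
    obtain ⟨⟨huv, -, ht, huv', -, -, -, hut, hvt⟩, hu, hw⟩ := hI
    simp only [Submodule.sub_mem_iff_right, hu] at huv
    simp [Fin.forall_fin_succ, *]
  · refine (h.centre_of_char_ne_two char_two).nonempty_wedge_algEquiv ![0, 1, 2]
      ![y 0, y 1, y 2] (by simp [twoRels, pow_succ _ k, pow_succ _ s, yk, ys, yt, y_mul])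
      (by simp [Fin.forall_fin_succ, y]) fun I hI => ?_
    simp only [twoRels, Set.mem_union, Set.mem_insert_iff, Set.mem_singleton_iff, or_imp,
      forall_and, forall_eq] at hI
    obtain ⟨⟨-, -, ht, huv, hut, hvt⟩, hu, hv⟩ := hI
    simp [Fin.forall_fin_succ, *]

open MvPolynomial in
theorem IsTypeOne.nonempty_algEquiv {l : ℕ} (h : IsTypeOne K A l) :
    Nonempty ((Subalgebra.center K A ⧸
      Module.annihilator (Subalgebra.center K A) (Ring.jacobson A)) ≃ₐ[K]
        WedgeAlgebra K ![l, 2, 2]) := by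
  have := h.symmetric.1
  let y := WedgeAlgebra.gen K ![l, 2, 2]
  have yu : y 0 ^ l = 0 := WedgeAlgebra.gen_pow K _ 0
  have yv : y 1 ^ 2 = 0 := WedgeAlgebra.gen_pow K _ 1
  have yw : y 2 ^ 2 = 0 := WedgeAlgebra.gen_pow K _ 2
  have y_mul {i j} : i ≠ j → y i * y j = 0 := WedgeAlgebra.gen_mul_gen K _
  by_cases char_two : CharP K 2
  · refine (h.centre_of_char_two char_two).nonempty_wedge_algEquiv ![0, 2, 3]
      ![y 0, 0, y 1, y 2] (by simp [oneRelsCharTwo, yu, yv, yw, y_mul])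
      (by simp [Fin.forall_fin_succ, y]) fun I hI => ?_
    simp only [oneRelsCharTwo, Set.mem_union, Set.mem_insert_iff, Set.mem_singleton_iff, or_imp,
      forall_and, forall_eq] at hI
    obtain ⟨⟨hU, -, hV, hW, -, hUV, hUW, -, -, hVW⟩, hT⟩ := hI
    simp [Fin.forall_fin_succ, *]
  · refine (h.centre_of_char_ne_two char_two).nonempty_wedge_algEquiv ![0, 1, 2]
      ![y 0, y 1, y 2] (by simp [oneRels, pow_succ _ l, yu, yv, yw, y_mul])
      (by simp [Fin.forall_fin_succ, y]) fun I hI => ?_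
    simp only [oneRels, Set.mem_union, Set.mem_insert_iff, Set.mem_singleton_iff, or_imp,
      forall_and, forall_eq] at hI
    obtain ⟨⟨-, hV, hW, hUV, hUW, hVW⟩, hU⟩ := hI
    simp [Fin.forall_fin_succ, *]

theorem IsTypeThree.hasCartanDetRatio {a b c : ℕ} (h : IsTypeThree K A a b c) (ha : a ≠ 0)
    (hb : b ≠ 0) (hc : c ≠ 0) : HasCartanDetRatio K A 4 := by
  have := h.symmetric.1
  obtain ⟨S, hS⟩ := h.cartan.exists_splitIdempotents h.basic
  refine ⟨3, S, ![a, b, c], by simp [Fin.forall_fin_succ, *], h.nonempty_algEquiv, ?_⟩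
  rw [hS, Matrix.det_fin_three, Fin.prod_univ_three]
  simp
  ring

theorem IsTypeTwo.hasCartanDetRatio {k s : ℕ} (h : IsTypeTwo K A k s) (hk : k ≠ 0)
    (hs : s ≠ 0) : HasCartanDetRatio K A 2 := by
  have := h.symmetric.1
  obtain ⟨S, hS⟩ := h.cartan.exists_splitIdempotents h.basic
  refine ⟨2, S, ![k, s, 2], by simp [Fin.forall_fin_succ, *], h.nonempty_algEquiv, ?_⟩
  rw [hS, Matrix.det_fin_two, Fin.prod_univ_three]
  simp
  ring

theorem IsTypeOne.exists_reynoldsIdeal_eq_span_singleton {l : ℕ} (h : IsTypeOne K A l) :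
    ∃ r : A, reynoldsIdeal K A = Submodule.span K {r} := by
  by_cases char_two : CharP K 2
  · obtain ⟨φ, hφ⟩ := h.centre_of_char_two char_two
    exact ⟨_, by rw [hφ, Set.image_singleton]⟩
  · obtain ⟨φ, hφ⟩ := h.centre_of_char_ne_two char_two
    exact ⟨_, by rw [hφ, Set.image_singleton]⟩

theorem IsTypeOne.hasCartanDetRatio {l : ℕ} (h : IsTypeOne K A l) (hl : l ≠ 0) :
    HasCartanDetRatio K A 1 := by
  have := h.symmetric.1
  have := h.indecomposable.1
  obtain ⟨r, hr⟩ := h.exists_reynoldsIdeal_eq_span_singleton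
  obtain ⟨S, hS⟩ := h.basic.exists_splitIdempotents_unit h.symmetric hr
  refine ⟨1, S, ![l, 2, 2], by simp [Fin.forall_fin_succ, hl], h.nonempty_algEquiv, ?_⟩
  rw [hS, h.finrank_eq, Fin.prod_univ_three]
  simp
  ring

end Classes

end StableMorita

theorem proposition6p6 (K : Type u) [Field K] :
    (∀ (A : Type v) [Ring A] [Algebra K A] (B : Type w) [Ring B] [Algebra K B] (a b c k s : ℕ),
      1 ≤ a → 1 ≤ b → 1 ≤ c → 1 ≤ k → 1 ≤ s →
      StableMorita.IsTypeThree K A a b c → StableMorita.IsTypeTwo K B k s →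
      ¬ StableMorita.StablyEquivalentOfMoritaType K A B) ∧
    (∀ (A : Type v) [Ring A] [Algebra K A] (B : Type w) [Ring B] [Algebra K B] (k s l : ℕ),
      1 ≤ k → 1 ≤ s → 2 ≤ l →
      StableMorita.IsTypeTwo K A k s → StableMorita.IsTypeOne K B l →
      ¬ StableMorita.StablyEquivalentOfMoritaType K A B) ∧
    (∀ (A : Type v) [Ring A] [Algebra K A] (B : Type w) [Ring B] [Algebra K B] (a b c l : ℕ),
      1 ≤ a → 1 ≤ b → 1 ≤ c → 2 ≤ l →
      StableMorita.IsTypeThree K A a b c → StableMorita.IsTypeOne K B l →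
      ¬ StableMorita.StablyEquivalentOfMoritaType K A B) := by
  refine ⟨fun A _ _ B _ _ a b c k s ha hb hc hk hs hA hB h => ?_,
    fun A _ _ B _ _ k s l hk hs hl hA hB h => ?_,
    fun A _ _ B _ _ a b c l ha hb hc hl hA hB h => ?_⟩
  · have ratioA := hA.hasCartanDetRatio (by omega) (by omega) (by omega)
    have ratioB := hB.hasCartanDetRatio (by omega) (by omega)
    exact absurd (ratioA.dvd ratioB four_ne_zero hA.symmetric hB.symmetric h) (by decide)
  · have ratioA := hA.hasCartanDetRatio (by omega) (by omega)
    have ratioB := hB.hasCartanDetRatio (by omega)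
    exact absurd (ratioA.dvd ratioB two_ne_zero hA.symmetric hB.symmetric h) (by decide)
  · have ratioA := hA.hasCartanDetRatio (by omega) (by omega) (by omega)
    have ratioB := hB.hasCartanDetRatio (by omega)
    exact absurd (ratioA.dvd ratioB four_ne_zero hA.symmetric hB.symmetric h) (by decide)
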